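/- **Theorem (Covariance of the LPDE solution).** *Error structure.* Let $(\Omega,\mathcal F,\mathbb P,\mathbb D,\Gamma)$ be an error structure: $(\Omega,\mathcal F,\mathbb P)$ is a probability space, $\mathbb D$ is a dense subspace of $L^2(\mathbb P)$, and $\Gamma:\mathbb D\times\mathbb D\to L^1(\mathbb P)$ is a positive symmetric bilinear map such that, for $u,v\in\mathbb D$ and $F,G$ Lipschitz and of class $C^1$, $F(u),G(v)\in\mathbb D$ and $\Gamma[F(u),G(v)]=F'(u)G'(v)\Gamma[u,v]$ a.s.; moreover $\mathbb D$ is complete for $\|u\|_{L^2}+\mathbb E[\Gamma[u,u]]$ (in the sense of Cauchy sequences). *Random terminal condition.* Let $\phi,\psi$ be the father and the mother wavelet of an orthonormal wavelet basis $\{\phi_{0,k}\}_{k\in\mathbb Z}\cup\{\psi_{i,k}\}_{i\ge 0,k\in\mathbb Z}$ of $L^2(\mathbb R)$, where $\phi_{0,k}(x)=\phi(x-k)$ and $\psi_{i,k}(x)=2^{i/2}\psi(2^ix-k)$ (for example Daubechies wavelets). Let $\alpha_k,\beta_{i,k}\in\mathbb D$ be random coefficients whose errors are uncorrelated ($\Gamma$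 vanishes on any two different coefficients) and proportional: $\Gamma[\alpha_k,\alpha_k]=\gamma(k)\alpha_k^2$ and $\Gamma[\beta_{i,k},\beta_{i,k}]=\gamma(i,k)\beta_{i,k}^2$ with real constants $\gamma(k),\gamma(i,k)$. Let $f$ be a random function such that, almost surely, $f\in L^2(\mathbb R)$ and $f=\sum_k\alpha_k\phi_{0,k}+\sum_i\sum_k\beta_{i,k}\psi_{i,k}$ in $L^2(\mathbb R)$. *Equation.* Let $O\subseteq\mathbb R$ be open and consider on $(-\infty,0]\times O$ the linear equation $$\partial_tu+\tfrac12\sigma(t,x)^2\,\partial_{xx}u+\mu(t,x)\,\partial_xu=0,\qquad u(0,\cdot)=g .$$ (The case $\mu=0$, $\sigma(t,x)=\sigma x^\lambda$ is the equation $\partial_t\widetilde Q+\frac{\sigma^2x^{2\lambda}}2\partial_{xx}\widetilde Q=0$.) A solution is a function $u$ of class $C^{1,2}$ on $(-\infty,0)\times O$ that satisfies the equation there and is such that $t\mapsto u(t,\cdot)$ is continuous from $(-\infty,0]$ to $L^2(O)$ with value $g|_O$ at $t=0$. Let $\mathcal U$ be a linear class of functions, which expresses growth or boundary conditions, if any,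 and which contains every solution that is a limit, in $L^2(O)$ uniformly on each $[-T,0]$, of solutions in $\mathcal U$ ($\mathcal U$ may be the class of all functions). Suppose that for every $g\in L^2(\mathbb R)$ the equation has exactly one solution in $\mathcal U$. Let $\widetilde Q$, and the diffusionlets $\Phi^D_{0,k}$ and $\Psi^D_{i,k}$, be the solutions in $\mathcal U$ with terminal conditions $f$ (almost surely), $\phi_{0,k}$ and $\psi_{i,k}$, respectively. *Conclusion.* Let $t,s<0$ and $x,y\in O$ be such that, for $(r,z)=(t,x)$ and for $(r,z)=(s,y)$, $\widetilde Q(r,z)\in L^2(\mathbb P)$ and $$\sum_k\gamma(k)\,\mathbb E[\alpha_k^2]\,\Phi^D_{0,k}(r,z)^2+\sum_i\sum_k\gamma(i,k)\,\mathbb E[\beta_{i,k}^2]\,\Psi^D_{i,k}(r,z)^2<\infty .$$ Then $\widetilde Q(t,x),\widetilde Q(s,y)\in\mathbb D$ and, almost surely, with absolutely convergent sums, $$\Gamma\big[\widetilde Q(t,x),\widetilde Q(s,y)\big]=\sum_k\gamma(k)\,\alpha_k^2\,\Phi^D_{0,k}(t,x)\,\Phi^D_{0,k}(s,y)+\sum_i\sum_k\gamma(i,k)\,\beta_{i,k}^2\,\Psi^D_{i,k}(t,x)\,\Psi^D_{i,k}(s,y).$$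 -/

import Mathlib

open MeasureTheory Filter Topology
open scoped ENNReal

/-- An error structure `(Ω, 𝓕, P, dom, Γ)` over the probability space `(Ω, 𝓕, P)`: a dense subspace
`dom` of `L²(P)` and a positive symmetric bilinear map `Γ : dom × dom → L¹(P)` that satisfies the
functional calculus for Lipschitz functions of class `C¹`, such that `dom` is complete for the norm
built from `‖u‖_{L²}` and `E[Γ[u, u]]`. -/
structure ErrorStructure {Ω : Type*} [MeasurableSpace Ω] (P : Measure Ω)
    [IsProbabilityMeasure P] where
  /-- the domain of the carré du champ -/
  dom : Submodule ℝ (Lp ℝ 2 P)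
  dense_dom : Dense (dom : Set (Lp ℝ 2 P))
  /-- the carré du champ -/
  Γ : dom →ₗ[ℝ] dom →ₗ[ℝ] Lp ℝ 1 P
  symm : ∀ u v : dom, Γ u v = Γ v u
  nonneg : ∀ u : dom, 0 ≤ᵐ[P] (Γ u u : Ω → ℝ)
  chain : ∀ F G : ℝ → ℝ, ContDiff ℝ 1 F → (∃ K, LipschitzWith K F) →
    ContDiff ℝ 1 G → (∃ K, LipschitzWith K G) → ∀ u v : dom,
    ∃ Fu Gv : dom,
      (fun ω => (Fu : Lp ℝ 2 P) ω) =ᵐ[P] (fun ω => F ((u : Lp ℝ 2 P) ω)) ∧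
      (fun ω => (Gv : Lp ℝ 2 P) ω) =ᵐ[P] (fun ω => G ((v : Lp ℝ 2 P) ω)) ∧
      (fun ω => Γ Fu Gv ω) =ᵐ[P]
        (fun ω => deriv F ((u : Lp ℝ 2 P) ω) * deriv G ((v : Lp ℝ 2 P) ω) * Γ u v ω)
  complete : ∀ w : ℕ → dom,
    (∀ ε > 0, ∃ N, ∀ m ≥ N, ∀ n ≥ N,
      ‖w m - w n‖ + ∫ ω, Γ (w m - w n) (w m - w n) ω ∂P < ε) →
    ∃ u : dom, Tendsto (fun n => ‖w n - u‖ + ∫ ω, Γ (w n - u) (w n - u) ω ∂P) atTop (𝓝 0)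

/-- The translate `φ_{0,k}(x) = φ(x - k)` of the father wavelet. -/
def fatherWavelet (φ : ℝ → ℝ) (k : ℤ) (x : ℝ) : ℝ := φ (x - k)

/-- The rescaled mother wavelet `ψ_{i,k}(x) = 2^{i/2} ψ(2^i x - k)`, for `p = (i, k)`. -/
noncomputable def motherWavelet (ψ : ℝ → ℝ) (p : ℕ × ℤ) (x : ℝ) : ℝ :=
  Real.sqrt (2 ^ p.1) * ψ (2 ^ p.1 * x - p.2)

/-- `φ` and `ψ` are the father and the mother wavelet of an orthonormal wavelet basis
`{φ_{0,k}} ∪ {ψ_{i,k}}` of `L²(ℝ)`. -/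
structure IsWaveletBasis (φ ψ : ℝ → ℝ) : Prop where
  memLp_father : MemLp φ 2 volume
  memLp_mother : MemLp ψ 2 volume
  orthonormal_father : ∀ k l : ℤ,
    ∫ x, fatherWavelet φ k x * fatherWavelet φ l x = if k = l then 1 else 0
  orthonormal_mother : ∀ p q : ℕ × ℤ,
    ∫ x, motherWavelet ψ p x * motherWavelet ψ q x = if p = q then 1 else 0
  orthogonal : ∀ (k : ℤ) (p : ℕ × ℤ), ∫ x, fatherWavelet φ k x * motherWavelet ψ p x = 0
  total : ∀ g : ℝ → ℝ, MemLp g 2 volume →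
    (∀ k, ∫ x, g x * fatherWavelet φ k x = 0) → (∀ p, ∫ x, g x * motherWavelet ψ p x = 0) →
    g =ᵐ[volume] 0

/-- `g ∈ L²(ℝ)` and `g = ∑ₖ aₖ φ_{0,k} + ∑ᵢ ∑ₖ b_{i,k} ψ_{i,k}` in `L²(ℝ)`. -/
def HasWaveletExpansion (φ ψ g : ℝ → ℝ) (a : ℤ → ℝ) (b : ℕ × ℤ → ℝ) : Prop :=
  MemLp g 2 volume ∧
  Tendsto (fun J : Finset ℤ × Finset (ℕ × ℤ) =>
      eLpNorm (fun x => g x - (∑ k ∈ J.1, a k * fatherWavelet φ k x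
        + ∑ p ∈ J.2, b p * motherWavelet ψ p x)) 2 volume)
    atTop (𝓝 0)

/-- `u` solves, on `(-∞, 0] × O`, the linear equation
`∂ₜu + (σ(t,x)² / 2) ∂ₓₓu + μ(t,x) ∂ₓu = 0` with terminal condition `u(0, ·) = g`: it is of class
`C^{1,2}` and satisfies the equation pointwise for `t < 0`, and `t ↦ u(t, ·)` is continuous from
`(-∞, 0]` to `L²(O)` with value `g` at `t = 0`. -/
structure IsLPDESolution (σ μ : ℝ → ℝ → ℝ) (O : Set ℝ) (g : ℝ → ℝ) (u : ℝ → ℝ → ℝ) : Prop where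
  differentiableAt_time : ∀ t < 0, ∀ x ∈ O, DifferentiableAt ℝ (fun τ => u τ x) t
  differentiableAt_space : ∀ t < 0, ∀ x ∈ O, DifferentiableAt ℝ (u t) x
  differentiableAt_deriv_space : ∀ t < 0, ∀ x ∈ O, DifferentiableAt ℝ (deriv (u t)) x
  continuousOn : ContinuousOn (fun p : ℝ × ℝ => u p.1 p.2) (Set.Iio 0 ×ˢ O)
  continuousOn_time :
    ContinuousOn (fun p : ℝ × ℝ => deriv (fun τ => u τ p.2) p.1) (Set.Iio 0 ×ˢ O)
  continuousOn_space : ContinuousOn (fun p : ℝ × ℝ => deriv (u p.1) p.2) (Set.Iio 0 ×ˢ O)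
  continuousOn_space_space :
    ContinuousOn (fun p : ℝ × ℝ => deriv (deriv (u p.1)) p.2) (Set.Iio 0 ×ˢ O)
  equation : ∀ t < 0, ∀ x ∈ O,
    deriv (fun τ => u τ x) t + σ t x ^ 2 / 2 * deriv (deriv (u t)) x + μ t x * deriv (u t) x = 0
  memLp : ∀ t ≤ 0, MemLp (u t) 2 (volume.restrict O)
  continuous_L2 : ∀ t ≤ 0,
    Tendsto (fun τ => eLpNorm (u τ - u t) 2 (volume.restrict O)) (𝓝[Set.Iic 0] t) (𝓝 0)
  terminal : u 0 =ᵐ[volume.restrict O] g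

/-- The equation has exactly one solution in the linear class `𝒰` for every terminal condition in
`L²(ℝ)`. The class `𝒰` stands for the growth or boundary conditions that are imposed on solutions,
if any (`𝒰 = ⊤` if there are none); such conditions are linear and pass to limits of solutions in
`C((-∞, 0]; L²(O))`. -/
structure LPDEUniquelySolvable (σ μ : ℝ → ℝ → ℝ) (O : Set ℝ)
    (𝒰 : Submodule ℝ (ℝ → ℝ → ℝ)) : Prop where
  closed : ∀ (g : ℕ → ℝ → ℝ) (u : ℕ → ℝ → ℝ → ℝ) (g' : ℝ → ℝ) (u' : ℝ → ℝ → ℝ),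
    (∀ n, u n ∈ 𝒰 ∧ IsLPDESolution σ μ O (g n) (u n)) → IsLPDESolution σ μ O g' u' →
    (∀ T : ℝ, Tendsto (fun n => ⨆ t ∈ Set.Icc (-T) 0,
      eLpNorm (u n t - u' t) 2 (volume.restrict O)) atTop (𝓝 0)) →
    u' ∈ 𝒰
  existence : ∀ g : ℝ → ℝ, MemLp g 2 volume → ∃ u ∈ 𝒰, IsLPDESolution σ μ O g u
  uniqueness : ∀ (g : ℝ → ℝ) (u v : ℝ → ℝ → ℝ), MemLp g 2 volume → u ∈ 𝒰 → v ∈ 𝒰 →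
    IsLPDESolution σ μ O g u → IsLPDESolution σ μ O g v → ∀ t < 0, ∀ x ∈ O, u t x = v t x

/-- The coefficients `α k`, `β (i, k)` (elements of the domain) have uncorrelated errors. -/
structure ErrorStructure.Uncorrelated {Ω : Type*} [MeasurableSpace Ω] {P : Measure Ω}
    [IsProbabilityMeasure P] (S : ErrorStructure P) (α : ℤ → S.dom) (β : ℕ × ℤ → S.dom) :
    Prop where
  father : ∀ k l, k ≠ l → S.Γ (α k) (α l) = 0
  mother : ∀ p q, p ≠ q → S.Γ (β p) (β q) = 0
  father_mother : ∀ k p, S.Γ (α k) (β p) = 0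

/-- The error on each coefficient is proportional to it: `Γ[αₖ, αₖ] = γ(k) αₖ²` and
`Γ[β_{i,k}, β_{i,k}] = γ(i,k) β_{i,k}²`. -/
structure ErrorStructure.Proportional {Ω : Type*} [MeasurableSpace Ω] {P : Measure Ω}
    [IsProbabilityMeasure P] (S : ErrorStructure P) (α : ℤ → S.dom) (β : ℕ × ℤ → S.dom)
    (γ : ℤ → ℝ) (γ' : ℕ × ℤ → ℝ) : Prop where
  father : ∀ k, (fun ω => S.Γ (α k) (α k) ω) =ᵐ[P] fun ω => γ k * (α k : Lp ℝ 2 P) ω ^ 2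
  mother : ∀ p, (fun ω => S.Γ (β p) (β p) ω) =ᵐ[P] fun ω => γ' p * (β p : Lp ℝ 2 P) ω ^ 2

/-! The argument has a deterministic half and a probabilistic half.

Deterministic half: for t < 0 and x ∈ O, the value u(t, x) is a continuous linear functional of the
terminal condition in L²(ℝ). No estimate on the equation is available; existence, uniqueness and
closedness of the class replace it. Record a solution by its jet, i.e. u, ∂ₜu, ∂ₓu, ∂ₓₓu on the open
domain and its path in L²(O), in a complete metrizable space. A limit of jets of solutions is the
jet of a solution (`exists_jet_of_tendsto`), so the map from terminal condition to jet has closed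
graph and is continuous (`continuous_solutionMap`). Applying evaluation at a point to the wavelet
expansion of f gives, almost surely, a convergent series for the solution, with the values of the
diffusionlets as weights.

Probabilistic half: this series converges only almost surely, and need not be assumed to converge in
L²(P). By bounded truncations and convex combinations, the energy E[Γ[u, u]] is lower semicontinuous
even for almost sure convergence to an element of L² (`exists_mem_dom_of_ae_tendsto`). Applied to
the tails of the series, whose energies add up because the errors are uncorrelated, this puts the
sum in the domain and makes the partial sums converge in energy. Then Γ of the partial sums
converges in L¹, and nonnegativity of the diagonal terms upgrades this to almost sure absolute
convergence. -/

/-- A linear map from a Banach space into a topological vector space is almost open in the sense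
that closures of preimages of neighbourhoods of zero are neighbourhoods of zero. -/
theorem LinearMap.closure_preimage_mem_nhds_zero {X E : Type*} [NormedAddCommGroup X]
    [NormedSpace ℝ X] [CompleteSpace X] [AddCommGroup E] [Module ℝ E] [TopologicalSpace E]
    [IsTopologicalAddGroup E] [ContinuousSMul ℝ E] (T : X →ₗ[ℝ] E) {W : Set E} (hW : W ∈ 𝓝 0) :
    closure (T ⁻¹' W) ∈ 𝓝 (0 : X) := by
  obtain ⟨V, hV, hVW⟩ : ∃ V ∈ 𝓝 (0 : E), ∀ v ∈ V, ∀ w ∈ V, v - w ∈ W := by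
    have h : Tendsto (fun p : E × E => p.1 - p.2) (𝓝 0 ×ˢ 𝓝 0) (𝓝 0) := by
      have := (continuous_sub (G := E)).tendsto (0, 0)
      rwa [sub_zero, nhds_prod_eq] at this
    obtain ⟨V, hV, hVW⟩ := Filter.mem_prod_same_iff.1 (h hW)
    exact ⟨V, hV, fun v hv w hw => hVW (Set.mk_mem_prod hv hw)⟩
  set A : Set X := T ⁻¹' V
  let c : ℕ → ℝ := fun n => n + 1
  have hc : ∀ n, c n ≠ 0 := fun n => by positivity
  -- Baire: the closed sets `c n • closure A` cover X, since `(c n)⁻¹ • T x` tends to zero, so one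
  -- of them has an interior point z.
  obtain ⟨n, z, hz⟩ : ∃ n, (interior {x : X | (c n)⁻¹ • x ∈ closure A}).Nonempty := by
    refine nonempty_interior_of_iUnion_of_closed
      (fun n => isClosed_closure.preimage (continuous_const_smul (c n)⁻¹)) ?_
    refine Set.eq_univ_of_forall fun x => ?_
    have h : Tendsto (fun n : ℕ => (c n)⁻¹ • T x) atTop (𝓝 0) := by
      have h0 : Tendsto (fun n : ℕ => (c n)⁻¹) atTop (𝓝 0) := by
        simpa [c, one_div] using tendsto_one_div_add_atTop_nhds_zero_nat (𝕜 := ℝ)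
      simpa using h0.smul_const (T x)
    obtain ⟨n, hn⟩ := (h.eventually_mem hV).exists
    refine Set.mem_iUnion.2 ⟨n, subset_closure ?_⟩
    simpa [A] using hn
  have hz' : ∀ᶠ y in 𝓝 z, (c n)⁻¹ • y ∈ closure A := mem_interior_iff_mem_nhds.1 hz
  have hlim : Tendsto (fun e : X => z + c n • e) (𝓝 0) (𝓝 z) := by
    have : Continuous fun e : X => z + c n • e := by fun_prop
    simpa using this.tendsto 0
  filter_upwards [hlim.eventually hz'] with e he
  have hza := hz'.self_of_nhds
  -- A small e is a difference of two points of `closure A`, hence lies in the closure of `A - A`,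
  -- and `T` maps `A - A` into W.
  have key : (c n)⁻¹ • (z + c n • e) - (c n)⁻¹ • z = e := by
    rw [smul_add, inv_smul_smul₀ (hc n)]; abel
  rw [← key]
  exact map_mem_closure₂ continuous_sub he hza fun a ha b hb => by
    simpa [A] using hVW _ ha _ hb

/-- The **closed graph theorem** for linear maps from a Banach space into a complete metrizable
topological vector space. -/
theorem LinearMap.continuous_of_seq_closed_graph_of_completeSpace {X E : Type*}
    [NormedAddCommGroup X] [NormedSpace ℝ X] [CompleteSpace X] [AddCommGroup E] [Module ℝ E]
    [UniformSpace E] [IsUniformAddGroup E] [ContinuousSMul ℝ E] [CompleteSpace E]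
    [FirstCountableTopology E] (T : X →ₗ[ℝ] E)
    (hT : ∀ (u : ℕ → X) (x : X) (y : E), Tendsto u atTop (𝓝 x) →
      Tendsto (fun n => T (u n)) atTop (𝓝 y) → y = T x) : Continuous T := by
  refine continuous_of_continuousAt_zero T.toAddMonoidHom ?_
  obtain ⟨u, hu, hadd⟩ := IsTopologicalAddGroup.exists_antitone_basis_nhds_zero E
  have hu_mem : ∀ n, u n ∈ 𝓝 (0 : E) := fun n => hu.1.mem_of_mem trivial
  have hr : ∀ n : ℕ, ∃ r > 0, r ≤ 1 / ((n : ℝ) + 1) ∧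
      Metric.ball (0 : X) r ⊆ closure (T ⁻¹' u n) := fun n => by
    obtain ⟨r, hr, h⟩ := Metric.mem_nhds_iff.1 (T.closure_preimage_mem_nhds_zero (hu_mem n))
    exact ⟨min r (1 / ((n : ℝ) + 1)), lt_min hr (by positivity), min_le_right _ _,
      (Metric.ball_subset_ball (min_le_left _ _)).trans h⟩
  choose r hr0 hr1 hrs using hr
  -- Successive approximation: almost openness lets the remainder e be replaced by a smaller e' at
  -- the cost of a step whose image is in `u n`. The value 0 only makes the choice total.
  have hstep : ∀ (n : ℕ) (e : X), ∃ e' : X, ‖e‖ < r n → T (e - e') ∈ u n ∧ ‖e'‖ < r (n + 1) := by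
    intro n e
    by_cases he : ‖e‖ < r n
    · obtain ⟨z, hz, hd⟩ := Metric.mem_closure_iff.1 (hrs n (mem_ball_zero_iff.2 he)) _ (hr0 (n + 1))
      exact ⟨e - z, fun _ => ⟨by simpa using hz, by rwa [← dist_eq_norm]⟩⟩
    · exact ⟨0, fun h => absurd h he⟩
  choose next hnext using hstep
  have hzero : T.toAddMonoidHom 0 = 0 := map_zero _
  rw [ContinuousAt, hzero]
  intro V hV
  obtain ⟨V', hV', hV'c, hV'V⟩ := exists_mem_nhds_isClosed_subset hV
  obtain ⟨m, -, hm⟩ := hu.1.mem_iff.1 hV'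
  change T ⁻¹' V ∈ 𝓝 0
  refine mem_of_superset (Metric.ball_mem_nhds 0 (hr0 (m + 1))) fun x hx => hV'V ?_
  let e : ℕ → X := fun n => Nat.rec x (fun n y => next (m + 1 + n) y) n
  have he : ∀ n, ‖e n‖ < r (m + 1 + n) := by
    intro n
    induction n with
    | zero => simpa [e] using hx
    | succ n ih => exact (hnext (m + 1 + n) (e n) ih).2
  have hTe : ∀ n, T (e n - e (n + 1)) ∈ u (m + 1 + n) := fun n => (hnext _ _ (he n)).1
  -- Since `u (n + 1) + u (n + 1) ⊆ u n`, a sum of successive steps loses only one index; starting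
  -- the remainders at `m + 1` makes the total land in `u m`.
  have hsum : ∀ k n, T (e n - e (n + k)) ∈ u (m + n) := by
    intro k
    induction k with
    | zero => intro n; simpa using mem_of_mem_nhds (hu_mem (m + n))
    | succ k ih =>
      intro n
      have h1 := hTe n
      have h2 := ih (n + 1)
      have h3 := hadd (m + n) (Set.add_mem_add (by convert h1 using 2; omega)
        (by convert h2 using 2; omega))
      rw [← map_add] at h3
      convert h3 using 2
      rw [show n + (k + 1) = n + 1 + k by omega]
      abel
  have he0 : Tendsto e atTop (𝓝 0) := by
    refine squeeze_zero_norm (fun n => ?_) (tendsto_one_div_add_atTop_nhds_zero_nat (𝕜 := ℝ))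
    refine (he n).le.trans ((hr1 _).trans ?_)
    refine one_div_le_one_div_of_le (by positivity) ?_
    push_cast; linarith [(Nat.cast_nonneg m : (0 : ℝ) ≤ m)]
  have hcauchy : CauchySeq fun n => T (x - e n) := by
    have hb := hu.1.uniformity_of_nhds_zero_swapped
    refine hb.cauchySeq_iff'.2 fun i _ => ⟨i, fun n hn => ?_⟩
    obtain ⟨k, rfl⟩ := Nat.exists_eq_add_of_le hn
    have h := hu.2 (Nat.le_add_left i m) (hsum k i)
    change T (x - e (i + k)) - T (x - e i) ∈ u i
    rwa [← map_sub, sub_sub_sub_cancel_left]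
  obtain ⟨y, hy⟩ := cauchySeq_tendsto_of_complete hcauchy
  have hyx : y = T x := hT (fun n => x - e n) x y (by simpa using tendsto_const_nhds.sub he0) hy
  have : y ∈ V' := hV'c.mem_of_tendsto hy (Eventually.of_forall fun n => hm (by
    simpa [e] using hsum n 0))
  exact hyx ▸ this

/-! ### The complete metrizable space of jets -/

theorem ContinuousMap.isUniformAddGroup {α β : Type*} [TopologicalSpace α] [AddCommGroup β]
    [UniformSpace β] [IsUniformAddGroup β] : IsUniformAddGroup C(α, β) :=
  ContinuousMap.isUniformEmbedding_toUniformOnFunIsCompact.isUniformInducing.isUniformAddGroup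
    (⟨⟨ContinuousMap.toUniformOnFunIsCompact, rfl⟩, fun _ _ => rfl⟩ :
      C(α, β) →+ UniformOnFun α β {K | IsCompact K})

/-- The open space-time domain on which the equation is satisfied. -/
abbrev PastDomain (O : Set ℝ) : Type := ↥(Set.Iio (0 : ℝ) ×ˢ O)

/-- The space in which `(u, ∂ₜu, ∂ₓu, ∂ₓₓu)` and the path `t ↦ u(t, ·)` live, for a solution `u`. -/
abbrev JetSpace (O : Set ℝ) : Type :=
  C(PastDomain O, ℝ) × C(PastDomain O, ℝ) × C(PastDomain O, ℝ) × C(PastDomain O, ℝ) ×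
    C(Set.Iic (0 : ℝ), Lp ℝ 2 (volume.restrict O))

theorem JetSpace.isUniformAddGroup (O : Set ℝ) : IsUniformAddGroup (JetSpace O) := by
  have h1 : IsUniformAddGroup C(PastDomain O, ℝ) := ContinuousMap.isUniformAddGroup
  have h2 : IsUniformAddGroup C(Set.Iic (0 : ℝ), Lp ℝ 2 (volume.restrict O)) :=
    ContinuousMap.isUniformAddGroup
  infer_instance

/-- Both base spaces are locally compact and σ-compact, so countably many compact sets suffice to
describe the compact-open topologies. -/
theorem JetSpace.firstCountableTopology {O : Set ℝ} (hO : IsOpen O) :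
    FirstCountableTopology (JetSpace O) := by
  have : LocallyCompactSpace (PastDomain O) := (isOpen_Iio.prod hO).locallyCompactSpace
  have : WeaklyLocallyCompactSpace (Set.Iic (0 : ℝ)) :=
    isClosed_Iic.isClosedEmbedding_subtypeVal.weaklyLocallyCompactSpace
  have : SigmaCompactSpace (Set.Iic (0 : ℝ)) := isClosed_Iic.sigmaCompactSpace
  have h1 : FirstCountableTopology C(PastDomain O, ℝ) := inferInstance
  have h2 : FirstCountableTopology C(Set.Iic (0 : ℝ), Lp ℝ 2 (volume.restrict O)) := inferInstance
  infer_instance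

theorem JetSpace.completeSpace {O : Set ℝ} (hO : IsOpen O) : CompleteSpace (JetSpace O) := by
  have : LocallyCompactSpace (PastDomain O) := (isOpen_Iio.prod hO).locallyCompactSpace
  infer_instance

/-! ### Solutions and their jets -/

namespace IsLPDESolution

variable {σ μ : ℝ → ℝ → ℝ} {O : Set ℝ} {g h : ℝ → ℝ} {u v : ℝ → ℝ → ℝ}

theorem continuous_toLp (hu : IsLPDESolution σ μ O g u) :
    Continuous fun t : Set.Iic (0 : ℝ) => (hu.memLp t t.2).toLp (u t) := by
  refine continuous_iff_continuousAt.2 fun t => ?_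
  rw [ContinuousAt, tendsto_iff_edist_tendsto_0]
  simp only [Lp.edist_toLp_toLp]
  have h := hu.continuous_L2 t t.2
  rw [nhdsWithin_eq_map_subtype_coe t.2] at h
  exact tendsto_map'_iff.1 h

/-- The function, its derivatives and the path in `L²(O)` of a solution. -/
noncomputable def jet (hu : IsLPDESolution σ μ O g u) : JetSpace O :=
  (⟨fun p => u p.1.1 p.1.2, continuousOn_iff_continuous_domRestrict.1 hu.continuousOn⟩,
   ⟨fun p => deriv (fun τ => u τ p.1.2) p.1.1,
     continuousOn_iff_continuous_domRestrict.1 hu.continuousOn_time⟩,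
   ⟨fun p => deriv (u p.1.1) p.1.2, continuousOn_iff_continuous_domRestrict.1 hu.continuousOn_space⟩,
   ⟨fun p => deriv (deriv (u p.1.1)) p.1.2,
     continuousOn_iff_continuous_domRestrict.1 hu.continuousOn_space_space⟩,
   ⟨fun t => (hu.memLp t t.2).toLp (u t), hu.continuous_toLp⟩)

theorem coeFn_jet_path (hu : IsLPDESolution σ μ O g u) (t : Set.Iic (0 : ℝ)) :
    hu.jet.2.2.2.2 t =ᵐ[volume.restrict O] u t :=
  MemLp.coeFn_toLp (hu.memLp t t.2)

/-- A function whose derivatives and path in `L²(O)` are given by an element of the jet space that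
satisfies the equation is a solution. -/
theorem exists_jet_eq (w : JetSpace O) (h0 : ∀ p : PastDomain O, u p.1.1 p.1.2 = w.1 p)
    (ht : ∀ p : PastDomain O, HasDerivAt (fun τ => u τ p.1.2) (w.2.1 p) p.1.1)
    (hx : ∀ p : PastDomain O, HasDerivAt (u p.1.1) (w.2.2.1 p) p.1.2)
    (hxx : ∀ p : PastDomain O, HasDerivAt (deriv (u p.1.1)) (w.2.2.2.1 p) p.1.2)
    (heq : ∀ p : PastDomain O,
      w.2.1 p + σ p.1.1 p.1.2 ^ 2 / 2 * w.2.2.2.1 p + μ p.1.1 p.1.2 * w.2.2.1 p = 0)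
    (hw : ∀ t, w.2.2.2.2 t =ᵐ[volume.restrict O] u t) (hg : u 0 =ᵐ[volume.restrict O] g) :
    ∃ hu : IsLPDESolution σ μ O g u, hu.jet = w := by
  have hmem : ∀ t (h : t ≤ 0), MemLp (u t) 2 (volume.restrict O) := fun t h =>
    (Lp.memLp (w.2.2.2.2 ⟨t, h⟩)).ae_eq (hw ⟨t, h⟩)
  have hpath : ∀ t : Set.Iic (0 : ℝ), (hmem t t.2).toLp (u t) = w.2.2.2.2 t := fun t =>
    Lp.ext ((MemLp.coeFn_toLp _).trans (hw t).symm)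
  have hu : IsLPDESolution σ μ O g u :=
    { differentiableAt_time := fun t h x hxO => (ht ⟨(t, x), h, hxO⟩).differentiableAt
      differentiableAt_space := fun t h x hxO => (hx ⟨(t, x), h, hxO⟩).differentiableAt
      differentiableAt_deriv_space := fun t h x hxO => (hxx ⟨(t, x), h, hxO⟩).differentiableAt
      continuousOn := continuousOn_iff_continuous_domRestrict.2
        (w.1.continuous.congr fun p => (h0 p).symm)
      continuousOn_time := continuousOn_iff_continuous_domRestrict.2
        (w.2.1.continuous.congr fun p => (ht p).deriv.symm)
      continuousOn_space := continuousOn_iff_continuous_domRestrict.2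
        (w.2.2.1.continuous.congr fun p => (hx p).deriv.symm)
      continuousOn_space_space := continuousOn_iff_continuous_domRestrict.2
        (w.2.2.2.1.continuous.congr fun p => (hxx p).deriv.symm)
      equation := fun t h x hxO => by
        have := heq ⟨(t, x), h, hxO⟩
        rwa [← (ht ⟨(t, x), h, hxO⟩).deriv, ← (hx ⟨(t, x), h, hxO⟩).deriv,
          ← (hxx ⟨(t, x), h, hxO⟩).deriv] at this
      memLp := hmem
      continuous_L2 := fun t h => by
        have hc := (w.2.2.2.2.continuous.tendsto ⟨t, h⟩)
        rw [tendsto_iff_edist_tendsto_0] at hc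
        have hc' : Tendsto (fun τ : Set.Iic (0 : ℝ) => eLpNorm (u τ - u t) 2 (volume.restrict O))
            (𝓝 ⟨t, h⟩) (𝓝 0) := by
          refine hc.congr fun τ => ?_
          rw [← hpath τ, ← hpath ⟨t, h⟩, Lp.edist_toLp_toLp]
        rw [nhdsWithin_eq_map_subtype_coe (Set.mem_Iic.2 h)]
        exact tendsto_map'_iff.2 hc'
      terminal := hg }
  refine ⟨hu, ?_⟩
  refine Prod.ext (ContinuousMap.ext h0) (Prod.ext (ContinuousMap.ext fun p => (ht p).deriv)
    (Prod.ext (ContinuousMap.ext fun p => (hx p).deriv)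
      (Prod.ext (ContinuousMap.ext fun p => (hxx p).deriv) (ContinuousMap.ext hpath))))

theorem hasDerivAt_time (hu : IsLPDESolution σ μ O g u) (p : PastDomain O) :
    HasDerivAt (fun τ => u τ p.1.2) (hu.jet.2.1 p) p.1.1 :=
  (hu.differentiableAt_time _ p.2.1 _ p.2.2).hasDerivAt

theorem hasDerivAt_space (hu : IsLPDESolution σ μ O g u) (p : PastDomain O) :
    HasDerivAt (u p.1.1) (hu.jet.2.2.1 p) p.1.2 :=
  (hu.differentiableAt_space _ p.2.1 _ p.2.2).hasDerivAt

theorem hasDerivAt_deriv_space (hu : IsLPDESolution σ μ O g u) (p : PastDomain O) :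
    HasDerivAt (deriv (u p.1.1)) (hu.jet.2.2.2.1 p) p.1.2 :=
  (hu.differentiableAt_deriv_space _ p.2.1 _ p.2.2).hasDerivAt

theorem jet_equation (hu : IsLPDESolution σ μ O g u) (p : PastDomain O) :
    hu.jet.2.1 p + σ p.1.1 p.1.2 ^ 2 / 2 * hu.jet.2.2.2.1 p + μ p.1.1 p.1.2 * hu.jet.2.2.1 p = 0 :=
  hu.equation _ p.2.1 _ p.2.2

theorem exists_jet_linear_combination (hO : IsOpen O) (hu : IsLPDESolution σ μ O g u)
    (hv : IsLPDESolution σ μ O h v) (a b : ℝ) :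
    ∃ huv : IsLPDESolution σ μ O (a • g + b • h) (a • u + b • v),
      huv.jet = a • hu.jet + b • hv.jet := by
  refine exists_jet_eq _ (fun p => rfl)
    (fun p => ((hu.hasDerivAt_time p).const_smul a).add ((hv.hasDerivAt_time p).const_smul b))
    (fun p => ((hu.hasDerivAt_space p).const_smul a).add ((hv.hasDerivAt_space p).const_smul b))
    (fun p => ?_) (fun p => ?_) (fun t => ?_) ?_
  · refine (((hu.hasDerivAt_deriv_space p).const_smul a).add
      ((hv.hasDerivAt_deriv_space p).const_smul b)).congr_of_eventuallyEq ?_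
    filter_upwards [hO.mem_nhds p.2.2] with z hz
    exact (((hu.hasDerivAt_space ⟨(p.1.1, z), p.2.1, hz⟩).const_smul a).add
      ((hv.hasDerivAt_space ⟨(p.1.1, z), p.2.1, hz⟩).const_smul b)).deriv
  · have h1 := hu.jet_equation p
    have h2 := hv.jet_equation p
    simp only [Prod.fst_add, Prod.snd_add, Prod.smul_fst, Prod.smul_snd, ContinuousMap.add_apply,
      ContinuousMap.smul_apply, smul_eq_mul]
    linear_combination a * h1 + b * h2
  · filter_upwards [Lp.coeFn_add (a • hu.jet.2.2.2.2 t) (b • hv.jet.2.2.2.2 t),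
      Lp.coeFn_smul a (hu.jet.2.2.2.2 t), Lp.coeFn_smul b (hv.jet.2.2.2.2 t),
      hu.coeFn_jet_path t, hv.coeFn_jet_path t] with x h1 h2 h3 h4 h5
    change (a • hu.jet.2.2.2.2 t + b • hv.jet.2.2.2.2 t : Lp ℝ 2 (volume.restrict O)) x = _
    rw [h1, Pi.add_apply, h2, h3, Pi.smul_apply, Pi.smul_apply, h4, h5]
    rfl
  · filter_upwards [hu.terminal, hv.terminal] with x h1 h2
    simp [h1, h2]

/-- Openness of the domain makes derivatives depend only on values there. The values at t = 0 are
not compared pointwise, so the path at that time is settled by the terminal conditions. -/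
theorem jet_eq_of_eqOn (hO : IsOpen O) (hu : IsLPDESolution σ μ O g u)
    (hv : IsLPDESolution σ μ O h v) (huv : ∀ t < 0, ∀ x ∈ O, u t x = v t x)
    (hgh : g =ᵐ[volume.restrict O] h) : hu.jet = hv.jet := by
  have hx : ∀ p : PastDomain O, HasDerivAt (u p.1.1) (hv.jet.2.2.1 p) p.1.2 := fun p => by
    refine (hv.hasDerivAt_space p).congr_of_eventuallyEq ?_
    filter_upwards [hO.mem_nhds p.2.2] with z hz using huv _ p.2.1 _ hz
  have hw : ∀ t : Set.Iic (0 : ℝ), hv.jet.2.2.2.2 t =ᵐ[volume.restrict O] u t := fun t => by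
    refine (hv.coeFn_jet_path t).trans ?_
    rcases (Set.mem_Iic.1 t.2).lt_or_eq with h0 | h0
    · filter_upwards [ae_restrict_mem hO.measurableSet] with x hxO using (huv _ h0 _ hxO).symm
    · rw [h0]
      exact hv.terminal.trans (hgh.symm.trans hu.terminal.symm)
  refine (exists_jet_eq (σ := σ) (μ := μ) (u := u) (g := g) hv.jet
    (fun p => huv _ p.2.1 _ p.2.2) (fun p => ?_) hx (fun p => ?_) hv.jet_equation hw
    hu.terminal).choose_spec
  · refine (hv.hasDerivAt_time p).congr_of_eventuallyEq ?_
    filter_upwards [isOpen_Iio.mem_nhds p.2.1] with τ hτ using huv _ hτ _ p.2.2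
  · refine (hv.hasDerivAt_deriv_space p).congr_of_eventuallyEq ?_
    filter_upwards [hO.mem_nhds p.2.2] with z hz
    exact (hx ⟨(p.1.1, z), p.2.1, hz⟩).deriv

end IsLPDESolution

/-! ### Limits of jets of solutions -/

namespace IsLPDESolution

variable {σ μ : ℝ → ℝ → ℝ} {O : Set ℝ}

/-- Convergence of jets is locally uniform for the function and its derivatives, so differentiation
and the equation pass to the limit. -/
theorem exists_jet_of_tendsto (hO : IsOpen O) {g : ℕ → ℝ → ℝ} {u : ℕ → ℝ → ℝ → ℝ} {g' : ℝ → ℝ}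
    (hu : ∀ n, IsLPDESolution σ μ O (g n) (u n)) {w : JetSpace O}
    (hw : Tendsto (fun n => (hu n).jet) atTop (𝓝 w))
    (hg : w.2.2.2.2 ⟨0, Set.mem_Iic.2 le_rfl⟩ =ᵐ[volume.restrict O] g') :
    ∃ (v : ℝ → ℝ → ℝ) (hv : IsLPDESolution σ μ O g' v), hv.jet = w := by
  classical
  have hLC : LocallyCompactSpace (PastDomain O) := (isOpen_Iio.prod hO).locallyCompactSpace
  have l0 := ((continuous_fst.tendsto w).comp hw)
  have l1 := (((continuous_fst.comp continuous_snd).tendsto w).comp hw)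
  have l2 := (((continuous_fst.comp (continuous_snd.comp continuous_snd)).tendsto w).comp hw)
  have l3 := (((continuous_fst.comp (continuous_snd.comp
    (continuous_snd.comp continuous_snd))).tendsto w).comp hw)
  have l4 := (((continuous_snd.comp (continuous_snd.comp
    (continuous_snd.comp continuous_snd))).tendsto w).comp hw)
  -- Extension of a function on the domain by a filler depending on x alone. With filler `g'`, the
  -- limit takes its terminal value exactly at t = 0; for the derivatives the filler 0 is
  -- immaterial.
  let ext : C(PastDomain O, ℝ) → (ℝ → ℝ) → ℝ → ℝ → ℝ := fun c d t x =>
    if h : ((t, x) : ℝ × ℝ) ∈ Set.Iio (0 : ℝ) ×ˢ O then c ⟨(t, x), h⟩ else d x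
  have hext : ∀ c d (p : PastDomain O), ext c d p.1.1 p.1.2 = c p := fun c d p => dif_pos p.2
  have hloc : ∀ (c : C(PastDomain O, ℝ)) (d : ℝ → ℝ) (F : ℕ → C(PastDomain O, ℝ))
      (f : ℕ → ℝ × ℝ → ℝ) (_ : ∀ n (p : PastDomain O), F n p = f n p.1), Tendsto F atTop (𝓝 c) →
      TendstoLocallyUniformlyOn f (fun p => ext c d p.1 p.2) atTop (Set.Iio (0 : ℝ) ×ˢ O) := by
    intro c d F f hFf hF
    rw [tendstoLocallyUniformlyOn_iff_tendstoLocallyUniformly_comp_coe]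
    have h := ContinuousMap.tendsto_iff_tendstoLocallyUniformly.1 hF
    convert h using 2
    · ext p
      exact (hFf _ p).symm
    · ext p
      exact hext c d p
  have hcx : ∀ t : ℝ, Continuous fun x : ℝ => (t, x) := fun t => by fun_prop
  have hct : ∀ x : ℝ, Continuous fun t : ℝ => (t, x) := fun x => by fun_prop
  have hpt : ∀ (F : ℕ → C(PastDomain O, ℝ)) (c : C(PastDomain O, ℝ)) (p : PastDomain O),
      Tendsto F atTop (𝓝 c) → Tendsto (fun n => F n p) atTop (𝓝 (c p)) := fun F c p hF =>
    ((continuous_eval_const p).tendsto c).comp hF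
  have dt : ∀ p : PastDomain O, HasDerivAt (fun τ => ext w.1 g' τ p.1.2) (w.2.1 p) p.1.1 := by
    intro p
    have h1 := (hloc w.2.1 0 _ (fun n q => deriv (fun τ => u n τ q.2) q.1) (fun n q => rfl) l1).comp
      (fun t => (t, p.1.2)) (t := Set.Iio 0) (fun t ht => ⟨ht, p.2.2⟩) (hct _).continuousOn
    have h2 := hasDerivAt_of_tendstoLocallyUniformlyOn isOpen_Iio h1
      (f := fun n τ => u n τ p.1.2) (g := fun τ => ext w.1 g' τ p.1.2)
      (Eventually.of_forall fun n t ht => (hu n).hasDerivAt_time ⟨(t, p.1.2), ht, p.2.2⟩)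
      (fun t ht => by
        have := hpt _ _ ⟨(t, p.1.2), ht, p.2.2⟩ l0
        rwa [← hext _ g'] at this) p.2.1
    simpa only [Function.comp_apply, hext] using h2
  have dx : ∀ p : PastDomain O, HasDerivAt (ext w.1 g' p.1.1) (w.2.2.1 p) p.1.2 := by
    intro p
    have h1 := (hloc w.2.2.1 0 _ (fun n q => deriv (u n q.1) q.2) (fun n q => rfl) l2).comp
      (fun x => (p.1.1, x)) (t := O) (fun x hx => ⟨p.2.1, hx⟩) (hcx _).continuousOn
    have h2 := hasDerivAt_of_tendstoLocallyUniformlyOn hO h1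
      (f := fun n => u n p.1.1) (g := ext w.1 g' p.1.1)
      (Eventually.of_forall fun n x hx => (hu n).hasDerivAt_space ⟨(p.1.1, x), p.2.1, hx⟩)
      (fun x hx => by
        have := hpt _ _ ⟨(p.1.1, x), p.2.1, hx⟩ l0
        rwa [← hext _ g'] at this) p.2.2
    simpa only [Function.comp_apply, hext] using h2
  have dxx : ∀ p : PastDomain O,
      HasDerivAt (deriv (ext w.1 g' p.1.1)) (w.2.2.2.1 p) p.1.2 := by
    intro p
    have h1 := (hloc w.2.2.2.1 0 _ (fun n q => deriv (deriv (u n q.1)) q.2)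
      (fun n q => rfl) l3).comp
      (fun x => (p.1.1, x)) (t := O) (fun x hx => ⟨p.2.1, hx⟩) (hcx _).continuousOn
    have h2 := hasDerivAt_of_tendstoLocallyUniformlyOn hO h1
      (f := fun n => deriv (u n p.1.1)) (g := deriv (ext w.1 g' p.1.1))
      (Eventually.of_forall fun n x hx => (hu n).hasDerivAt_deriv_space ⟨(p.1.1, x), p.2.1, hx⟩)
      (fun x hx => by
        have := hpt _ _ ⟨(p.1.1, x), p.2.1, hx⟩ l2
        exact (dx ⟨(p.1.1, x), p.2.1, hx⟩).deriv ▸ this) p.2.2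
    simpa only [Function.comp_apply, hext] using h2
  refine ⟨ext w.1 g', exists_jet_eq w (hext _ _) dt dx dxx (fun p => ?_) (fun t => ?_) ?_⟩
  · refine tendsto_nhds_unique ?_ (tendsto_const_nhds (x := (0 : ℝ)) (f := atTop (α := ℕ)))
    refine Tendsto.congr (fun n => (hu n).jet_equation p) ?_
    exact ((hpt _ _ p l1).add ((hpt _ _ p l3).const_mul _)).add ((hpt _ _ p l2).const_mul _)
  · rcases (Set.mem_Iic.1 t.2).lt_or_eq with h0 | h0
    -- The L² limit and the pointwise limit agree: a subsequence of the paths at time t converges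
    -- almost everywhere.
    · have l5 := ((continuous_eval_const t).tendsto _).comp l4
      obtain ⟨ns, hns, hae⟩ := (tendstoInMeasure_of_tendsto_Lp l5).exists_seq_tendsto_ae
      have hcoe := ae_all_iff.2 fun n => (hu n).coeFn_jet_path t
      filter_upwards [ae_restrict_mem hO.measurableSet, hae, hcoe] with x hx h1 h2
      refine tendsto_nhds_unique h1 ?_
      have h3 := (hpt _ _ ⟨(t.1, x), h0, hx⟩ l0).comp hns.tendsto_atTop
      rw [← hext _ g'] at h3
      exact h3.congr fun n => (h2 (ns n)).symm
    · have : ext w.1 g' t = g' := by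
        ext x
        exact dif_neg fun h => (ne_of_lt h.1) h0
      rw [this]
      convert hg
  · have : ext w.1 g' 0 = g' := by
      ext x
      exact dif_neg fun h => lt_irrefl (0 : ℝ) h.1
    rw [this]

end IsLPDESolution

/-! ### Continuous dependence on the terminal condition -/

namespace LPDEUniquelySolvable

variable {σ μ : ℝ → ℝ → ℝ} {O : Set ℝ} {𝒰 : Submodule ℝ (ℝ → ℝ → ℝ)}

/-- The solution in the class `𝒰` with a given terminal condition in `L²(ℝ)`. -/
noncomputable def solution (H : LPDEUniquelySolvable σ μ O 𝒰) (g : Lp ℝ 2 (volume : Measure ℝ)) :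
    ℝ → ℝ → ℝ :=
  (H.existence g (Lp.memLp g)).choose

theorem solution_mem (H : LPDEUniquelySolvable σ μ O 𝒰) (g : Lp ℝ 2 (volume : Measure ℝ)) :
    H.solution g ∈ 𝒰 :=
  (H.existence g (Lp.memLp g)).choose_spec.1

theorem isLPDESolution_solution (H : LPDEUniquelySolvable σ μ O 𝒰)
    (g : Lp ℝ 2 (volume : Measure ℝ)) : IsLPDESolution σ μ O g (H.solution g) :=
  (H.existence g (Lp.memLp g)).choose_spec.2

/-- Uniqueness concerns only t < 0 and x ∈ O, so the jet, rather than the chosen function, is what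
depends canonically and linearly on the class of the terminal condition. -/
theorem jet_solution_eq (H : LPDEUniquelySolvable σ μ O 𝒰) (hO : IsOpen O)
    {g : Lp ℝ 2 (volume : Measure ℝ)} {h : ℝ → ℝ} {u : ℝ → ℝ → ℝ} (hgh : h =ᵐ[volume] g)
    (hu𝒰 : u ∈ 𝒰) (hu : IsLPDESolution σ μ O h u) :
    (H.isLPDESolution_solution g).jet = hu.jet := by
  have hgh' := ae_restrict_of_ae (s := O) hgh
  refine IsLPDESolution.jet_eq_of_eqOn hO _ hu ?_ (ae_eq_symm hgh')
  exact H.uniqueness g _ _ (Lp.memLp g) (H.solution_mem g) hu𝒰 (H.isLPDESolution_solution g)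
    { hu with terminal := hu.terminal.trans hgh' }

/-- The linear map that sends a terminal condition to the jet of its solution. -/
noncomputable def solutionMap (H : LPDEUniquelySolvable σ μ O 𝒰) (hO : IsOpen O) :
    Lp ℝ 2 (volume : Measure ℝ) →ₗ[ℝ] JetSpace O where
  toFun g := (H.isLPDESolution_solution g).jet
  map_add' f g := by
    obtain ⟨h, hj⟩ := (H.isLPDESolution_solution f).exists_jet_linear_combination hO
      (H.isLPDESolution_solution g) 1 1
    rw [H.jet_solution_eq hO ?_ ?_ h, hj, one_smul, one_smul]
    · simpa only [one_smul] using (Lp.coeFn_add f g).symm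
    · exact add_mem (𝒰.smul_mem _ (H.solution_mem f)) (𝒰.smul_mem _ (H.solution_mem g))
  map_smul' c g := by
    obtain ⟨h, hj⟩ := (H.isLPDESolution_solution g).exists_jet_linear_combination hO
      (H.isLPDESolution_solution g) c 0
    rw [H.jet_solution_eq hO ?_ ?_ h, hj, zero_smul, add_zero, RingHom.id_apply]
    · simpa only [zero_smul, add_zero] using (Lp.coeFn_smul c g).symm
    · exact add_mem (𝒰.smul_mem _ (H.solution_mem g)) (𝒰.smul_mem _ (H.solution_mem g))

theorem eLpNorm_sub_eq_edist {g h : ℝ → ℝ} {u v : ℝ → ℝ → ℝ} (hu : IsLPDESolution σ μ O g u)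
    (hv : IsLPDESolution σ μ O h v) (t : Set.Iic (0 : ℝ)) :
    eLpNorm (u t - v t) 2 (volume.restrict O) = edist (hu.jet.2.2.2.2 t) (hv.jet.2.2.2.2 t) :=
  (Lp.edist_toLp_toLp _ _ (hu.memLp t t.2) (hv.memLp t t.2)).symm

/-- Closed graph: a limit of jets is the jet of a solution whose terminal condition is the limit
one. Closedness of `𝒰` keeps this solution in the class, and uniqueness identifies it. -/
theorem continuous_solutionMap (H : LPDEUniquelySolvable σ μ O 𝒰) (hO : IsOpen O) :
    Continuous (H.solutionMap hO) := by
  have := JetSpace.isUniformAddGroup O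
  have := JetSpace.firstCountableTopology hO
  have := JetSpace.completeSpace hO
  refine LinearMap.continuous_of_seq_closed_graph_of_completeSpace _ fun g g' w hg hw => ?_
  have hpath : Tendsto (fun n => (H.solutionMap hO (g n)).2.2.2.2) atTop (𝓝 w.2.2.2.2) :=
    ((continuous_snd.comp (continuous_snd.comp (continuous_snd.comp continuous_snd))).tendsto
      w).comp hw
  have hmem : MemLp g' 2 (volume.restrict O) := (Lp.memLp g').restrict O
  have hw0 : w.2.2.2.2 ⟨0, Set.mem_Iic.2 le_rfl⟩ = hmem.toLp g' := by
    refine tendsto_nhds_unique (((continuous_eval_const _).tendsto _).comp hpath) ?_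
    rw [tendsto_iff_edist_tendsto_0] at hg ⊢
    refine tendsto_of_tendsto_of_tendsto_of_le_of_le tendsto_const_nhds hg (fun _ => zero_le)
      fun n => ?_
    rw [Lp.edist_def (g n)]
    refine le_trans (le_of_eq ?_) (eLpNorm_restrict_le _ _ _ O)
    refine (Lp.edist_toLp_toLp _ _ ((H.isLPDESolution_solution (g n)).memLp 0 le_rfl) hmem).trans (eLpNorm_congr_ae ?_)
    filter_upwards [(H.isLPDESolution_solution (g n)).terminal] with x hx
    simp [hx]
  obtain ⟨v, hv, rfl⟩ := IsLPDESolution.exists_jet_of_tendsto hO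
    (fun n => H.isLPDESolution_solution (g n)) hw (hw0 ▸ hmem.coeFn_toLp)
  refine (H.jet_solution_eq hO (ae_eq_refl _) ?_ hv).symm
  refine H.closed (fun n => g n) (fun n => H.solution (g n)) g' v
    (fun n => ⟨H.solution_mem _, H.isLPDESolution_solution _⟩) hv fun T => ?_
  -- The interval [-T, 0] is compact in the time domain, so compact-open convergence of the paths is
  -- the uniform convergence that `H.closed` requires.
  have hK : IsCompact {t : Set.Iic (0 : ℝ) | (t : ℝ) ∈ Set.Icc (-T) 0} :=
    isClosed_Iic.isClosedEmbedding_subtypeVal.isCompact_preimage isCompact_Icc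
  have hunif := ContinuousMap.tendsto_iff_forall_isCompact_tendstoUniformlyOn.1 hpath _ hK
  rw [EMetric.tendstoUniformlyOn_iff] at hunif
  refine ENNReal.tendsto_nhds_zero.2 fun ε hε => ?_
  filter_upwards [hunif ε hε] with n hn
  refine iSup₂_le fun t ht => ?_
  have h := hn ⟨t, ht.2⟩ ht
  rw [edist_comm] at h
  exact (eLpNorm_sub_eq_edist (H.isLPDESolution_solution (g n)) hv ⟨t, ht.2⟩).trans_le h.le

/-- The value of the solution at a point is a continuous linear functional of the terminal
condition. -/
theorem exists_continuousLinearMap_eval (H : LPDEUniquelySolvable σ μ O 𝒰) (hO : IsOpen O)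
    {t x : ℝ} (ht : t < 0) (hx : x ∈ O) :
    ∃ ℓ : Lp ℝ 2 (volume : Measure ℝ) →L[ℝ] ℝ, ∀ (g : ℝ → ℝ) (hg : MemLp g 2 volume)
      (u : ℝ → ℝ → ℝ), u ∈ 𝒰 → IsLPDESolution σ μ O g u → ℓ (hg.toLp g) = u t x := by
  let p : PastDomain O := ⟨(t, x), ht, hx⟩
  let E : JetSpace O →ₗ[ℝ] ℝ :=
    { toFun := fun w => w.1 p, map_add' := fun _ _ => rfl, map_smul' := fun _ _ => rfl }
  refine ⟨⟨E ∘ₗ H.solutionMap hO, ((continuous_eval_const p).comp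
    continuous_fst).comp (H.continuous_solutionMap hO)⟩, fun g hg u hu𝒰 hu => ?_⟩
  exact congrArg (fun w : JetSpace O => w.1 p) (H.jet_solution_eq hO hg.coeFn_toLp.symm hu𝒰 hu)

end LPDEUniquelySolvable

/-! ### Energy of an error structure and its lower semicontinuity -/

/-- Dominated convergence in `L²`. -/
theorem MeasureTheory.Lp.tendsto_two_of_dominated {Ω : Type*} [MeasurableSpace Ω] {P : Measure Ω}
    {f : ℕ → Lp ℝ 2 P} {g : Lp ℝ 2 P} {b : Ω → ℝ} (hb : MemLp b 2 P)
    (hf : ∀ n, ∀ᵐ ω ∂P, |f n ω| ≤ b ω)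
    (hfg : ∀ᵐ ω ∂P, Tendsto (fun n => f n ω) atTop (𝓝 (g ω))) : Tendsto f atTop (𝓝 g) := by
  have hnorm : ∀ n, ‖f n - g‖ ^ 2 = ∫ ω, (f n ω - g ω) ^ 2 ∂P := by
    intro n
    rw [← real_inner_self_eq_norm_sq, L2.inner_def]
    refine integral_congr_ae ?_
    filter_upwards [Lp.coeFn_sub (f n) g] with ω h
    rw [h, real_inner_self_eq_norm_sq, Real.norm_eq_abs, sq_abs, Pi.sub_apply]
  have hint : Tendsto (fun n => ∫ ω, (f n ω - g ω) ^ 2 ∂P) atTop (𝓝 (∫ _, (0 : ℝ) ∂P)) := by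
    refine tendsto_integral_of_dominated_convergence (fun ω => (2 * b ω) ^ 2)
      (fun n => (((Lp.aestronglyMeasurable _).sub (Lp.aestronglyMeasurable _)).pow 2))
      (hb.const_mul 2).integrable_sq (fun n => ?_) ?_
    · filter_upwards [hf n, ae_all_iff.2 hf, hfg] with ω h1 h2 h3
      have h4 : |g ω| ≤ b ω := le_of_tendsto h3.abs (Eventually.of_forall h2)
      rw [Real.norm_eq_abs, abs_of_nonneg (sq_nonneg _), sq_le_sq]
      have h5 : |f n ω - g ω| ≤ 2 * b ω := (abs_sub _ _).trans (by linarith)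
      exact h5.trans (le_abs_self _)
    · filter_upwards [hfg] with ω h
      simpa using (h.sub_const (g ω)).pow 2
  rw [integral_zero] at hint
  rw [tendsto_iff_norm_sub_tendsto_zero]
  have := (hint.congr fun n => (hnorm n).symm).sqrt
  simpa [Real.sqrt_sq (norm_nonneg _)] using this

namespace ErrorStructure

variable {Ω : Type*} [MeasurableSpace Ω] {P : Measure Ω} [IsProbabilityMeasure P]
  (S : ErrorStructure P)

/-- The expectation of the carré du champ, as a bilinear form. -/
noncomputable def energy : S.dom →ₗ[ℝ] S.dom →ₗ[ℝ] ℝ :=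
  S.Γ.compr₂ (L1.integralCLM (α := Ω) (E := ℝ) (μ := P)).toLinearMap

theorem energy_apply (u v : S.dom) : S.energy u v = ∫ ω, S.Γ u v ω ∂P := by
  rw [← L1.integral_eq_integral, L1.integral_eq]
  rfl

theorem energy_comm (u v : S.dom) : S.energy u v = S.energy v u := by
  rw [energy_apply, energy_apply, S.symm]

theorem energy_self_nonneg (u : S.dom) : 0 ≤ S.energy u u := by
  rw [energy_apply]
  exact integral_nonneg_of_ae (S.nonneg u)

theorem energy_neg_self (u : S.dom) : S.energy (-u) (-u) = S.energy u u := by simp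

/-- Positivity of Γ at u ± c v, integrated. Fixing c uses only two almost sure inequalities; the
discriminant in c is taken after integration. -/
theorem two_mul_norm_Γ_le (u v : S.dom) (c : ℝ) :
    2 * c * ‖S.Γ u v‖ ≤ S.energy u u + c ^ 2 * S.energy v v := by
  rcases le_or_gt c 0 with hc | hc
  · have h1 := S.energy_self_nonneg u
    have h2 := S.energy_self_nonneg v
    have h3 := norm_nonneg (S.Γ u v)
    nlinarith [mul_nonneg (sq_nonneg c) h2, mul_nonneg (neg_nonneg.2 hc) h3]
  have hi : ∀ f : Lp ℝ 1 P, Integrable f P := fun f => memLp_one_iff_integrable.1 (Lp.memLp f)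
  have hae : ∀ d : ℝ, ∀ᵐ ω ∂P, 0 ≤ S.Γ u u ω + 2 * d * S.Γ u v ω + d ^ 2 * S.Γ v v ω := by
    intro d
    have hΓ : S.Γ (u + d • v) (u + d • v) = S.Γ u u + (2 * d) • S.Γ u v + d ^ 2 • S.Γ v v := by
      simp only [map_add, map_smul, LinearMap.add_apply, LinearMap.smul_apply, S.symm v u]
      module
    filter_upwards [S.nonneg (u + d • v), Lp.coeFn_add (S.Γ u u + (2 * d) • S.Γ u v)
      (d ^ 2 • S.Γ v v), Lp.coeFn_add (S.Γ u u) ((2 * d) • S.Γ u v),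
      Lp.coeFn_smul (2 * d) (S.Γ u v), Lp.coeFn_smul (d ^ 2) (S.Γ v v)] with ω h0 h1 h2 h3 h4
    rw [hΓ, h1, Pi.add_apply, h2, Pi.add_apply, h3, h4] at h0
    simpa using h0
  have hle : ∀ᵐ ω ∂P, 2 * c * ‖S.Γ u v ω‖ ≤ S.Γ u u ω + c ^ 2 * S.Γ v v ω := by
    filter_upwards [hae c, hae (-c)] with ω h1 h2
    rw [Real.norm_eq_abs]
    rcases abs_cases (S.Γ u v ω) with ⟨h, -⟩ | ⟨h, -⟩ <;> rw [h] <;> linarith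
  have hint := integral_mono_ae ((hi (S.Γ u v)).norm.const_mul (2 * c))
    ((hi (S.Γ u u)).add ((hi (S.Γ v v)).const_mul (c ^ 2))) hle
  rw [L1.norm_eq_integral_norm, energy_apply, energy_apply]
  rw [integral_const_mul] at hint
  refine hint.trans_eq ?_
  simp only [Pi.add_apply]
  rw [integral_add (hi _) ((hi _).const_mul _), integral_const_mul]

/-- The Cauchy-Schwarz inequality for the carré du champ. -/
theorem norm_Γ_le (u v : S.dom) :
    ‖S.Γ u v‖ ≤ Real.sqrt (S.energy u u) * Real.sqrt (S.energy v v) := by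
  have h := discrim_le_zero (a := S.energy v v) (b := -2 * ‖S.Γ u v‖) (c := S.energy u u)
    fun c => by nlinarith [S.two_mul_norm_Γ_le u v c]
  rw [discrim] at h
  rw [← Real.sqrt_mul (S.energy_self_nonneg u)]
  exact Real.le_sqrt_of_sq_le (by nlinarith)

/-- Bilinearity leaves three terms, each containing an increment controlled by Cauchy-Schwarz;
convergence in energy alone is enough. -/
theorem tendsto_Γ {ι : Type*} {l : Filter ι} {u v : ι → S.dom} {u' v' : S.dom}
    (hu : Tendsto (fun n => S.energy (u n - u') (u n - u')) l (𝓝 0))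
    (hv : Tendsto (fun n => S.energy (v n - v') (v n - v')) l (𝓝 0)) :
    Tendsto (fun n => S.Γ (u n) (v n)) l (𝓝 (S.Γ u' v')) := by
  rw [tendsto_iff_norm_sub_tendsto_zero]
  have hu' : Tendsto (fun n => Real.sqrt (S.energy (u n - u') (u n - u'))) l (𝓝 0) := by
    simpa using hu.sqrt
  have hv' : Tendsto (fun n => Real.sqrt (S.energy (v n - v') (v n - v'))) l (𝓝 0) := by
    simpa using hv.sqrt
  have hlim := ((hu'.mul hv').add (hu'.mul_const (Real.sqrt (S.energy v' v')))).add
    (hv'.const_mul (Real.sqrt (S.energy u' u')))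
  simp only [mul_zero, zero_mul, add_zero] at hlim
  refine squeeze_zero (fun _ => norm_nonneg _) (fun n => ?_) hlim
  have key : S.Γ (u n) (v n) - S.Γ u' v' =
      S.Γ (u n - u') (v n - v') + S.Γ (u n - u') v' + S.Γ u' (v n - v') := by
    simp only [map_sub, LinearMap.sub_apply]
    abel
  rw [key]
  exact norm_add₃_le.trans (add_le_add_three (S.norm_Γ_le _ _) (S.norm_Γ_le _ _) (S.norm_Γ_le _ _))

theorem tendsto_energy {ι : Type*} {l : Filter ι} {u v : ι → S.dom} {u' v' : S.dom}
    (hu : Tendsto (fun n => S.energy (u n - u') (u n - u')) l (𝓝 0))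
    (hv : Tendsto (fun n => S.energy (v n - v') (v n - v')) l (𝓝 0)) :
    Tendsto (fun n => S.energy (u n) (v n)) l (𝓝 (S.energy u' v')) :=
  ((L1.integralCLM (α := Ω) (E := ℝ) (μ := P)).continuous.tendsto _).comp (S.tendsto_Γ hu hv)

/-- The energy is lower semicontinuous for convergence in `L²`. -/
theorem exists_mem_dom_of_tendsto {w : ℕ → S.dom} {W : Lp ℝ 2 P}
    (hw : Tendsto (fun n => (w n : Lp ℝ 2 P)) atTop (𝓝 W)) {C : ℝ}
    (hC : ∀ n, S.energy (w n) (w n) ≤ C) :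
    ∃ h : W ∈ S.dom, S.energy ⟨W, h⟩ ⟨W, h⟩ ≤ C := by
  -- Near-minimizers of the energy over convex hulls of the tails still converge to W, as balls are
  -- convex, and are in addition Cauchy in energy.
  let K : ℕ → Set S.dom := fun N => convexHull ℝ (w '' Set.Ici N)
  let e : S.dom → ℝ := fun u => S.energy u u
  have hK : ∀ N M, N ≤ M → K M ⊆ K N := fun N M h =>
    convexHull_mono (Set.image_mono (Set.Ici_subset_Ici.2 h))
  have hwK : ∀ N, w N ∈ K N := fun N => subset_convexHull _ _ ⟨N, Set.mem_Ici.2 le_rfl, rfl⟩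
  have hbdd : ∀ N, BddBelow (e '' K N) := fun N =>
    ⟨0, by rintro _ ⟨u, -, rfl⟩; exact S.energy_self_nonneg u⟩
  let d : ℕ → ℝ := fun N => sInf (e '' K N)
  have hd_le : ∀ N, ∀ u ∈ K N, d N ≤ e u := fun N u hu => csInf_le (hbdd N) ⟨u, hu, rfl⟩
  have hd_mono : Monotone d := fun N M h =>
    csInf_le_csInf (hbdd N) ⟨_, w M, hwK M, rfl⟩ (Set.image_mono (hK N M h))
  have hdC : ∀ N, d N ≤ C := fun N => (hd_le N _ (hwK N)).trans (hC N)
  have hv : ∀ N : ℕ, ∃ v ∈ K N, e v < d N + 1 / ((N : ℝ) + 1) := fun N => by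
    obtain ⟨_, ⟨v, hv, rfl⟩, h⟩ := exists_lt_of_csInf_lt (s := e '' K N) ⟨_, w N, hwK N, rfl⟩
      (lt_add_of_pos_right (d N) (by positivity : (0 : ℝ) < 1 / ((N : ℝ) + 1)))
    exact ⟨v, hv, h⟩
  choose v hvK hve using hv
  have hvW : Tendsto (fun n => (v n : Lp ℝ 2 P)) atTop (𝓝 W) := by
    rw [Metric.tendsto_atTop] at hw ⊢
    intro ε hε
    obtain ⟨N, hN⟩ := hw ε hε
    refine ⟨N, fun n hn => ?_⟩
    have hsub : K N ⊆ S.dom.subtype ⁻¹' Metric.ball W ε := by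
      refine convexHull_min ?_ ((convex_ball W ε).linear_preimage S.dom.subtype)
      rintro _ ⟨m, hm, rfl⟩
      exact hN m hm
    exact hsub (hK N n hn (hvK n))
  -- Parallelogram identity: the midpoint lies in `K N`, so its energy is at least `d N`, while the
  -- energies of the endpoints barely exceed `d M` and `d N`.
  have hpar : ∀ N M, N ≤ M → e (v M - v N) ≤
      2 * (d M - d N) + 2 * (1 / ((N : ℝ) + 1)) + 2 * (1 / ((M : ℝ) + 1)) := by
    intro N M h
    have hmid : (2⁻¹ : ℝ) • v M + (2⁻¹ : ℝ) • v N ∈ K N :=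
      convex_convexHull ℝ _ (hK N M h (hvK M)) (hvK N) (by norm_num) (by norm_num) (by norm_num)
    have h1 := hd_le N _ hmid
    have h2 := hve N
    have h3 := hve M
    simp only [e, map_add, map_smul, map_sub, LinearMap.add_apply, LinearMap.smul_apply,
      LinearMap.sub_apply, smul_eq_mul, S.energy_comm (v N) (v M)] at h1 h2 h3 ⊢
    linarith
  have hd_cauchy : CauchySeq d :=
    (tendsto_atTop_ciSup hd_mono ⟨C, by rintro _ ⟨N, rfl⟩; exact hdC N⟩).cauchySeq
  obtain ⟨u, hu⟩ := S.complete v fun ε hε => by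
    obtain ⟨N1, hN1⟩ := Metric.cauchySeq_iff.1 hvW.cauchySeq (ε / 4) (by positivity)
    obtain ⟨N2, hN2⟩ := Metric.cauchySeq_iff.1 hd_cauchy (ε / 16) (by positivity)
    obtain ⟨N3, hN3⟩ := exists_nat_one_div_lt (show (0 : ℝ) < ε / 16 by positivity)
    have hsmall : ∀ n ≥ N3, 1 / ((n : ℝ) + 1) < ε / 16 := fun n hn =>
      (one_div_le_one_div_of_le (by positivity)
        (by exact_mod_cast Nat.succ_le_succ hn)).trans_lt hN3
    refine ⟨max N1 (max N2 N3), fun m hm n hn => ?_⟩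
    simp only [ge_iff_le, max_le_iff] at hm hn
    have h1 : ‖v m - v n‖ < ε / 4 := by
      have := hN1 m hm.1 n hn.1
      rwa [dist_eq_norm] at this
    have h2 : e (v m - v n) ≤ ε / 2 := by
      rcases le_total n m with h | h
      · have := hN2 m hm.2.1 n hn.2.1
        rw [Real.dist_eq] at this
        linarith [hpar n m h, (abs_lt.1 this).2, hsmall m hm.2.2, hsmall n hn.2.2]
      · have := hN2 m hm.2.1 n hn.2.1
        rw [Real.dist_eq] at this
        have h3 := hpar m n h
        have h4 : e (v m - v n) = e (v n - v m) := by
          rw [← neg_sub]; exact S.energy_neg_self _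
        linarith [(abs_lt.1 this).1, hsmall m hm.2.2, hsmall n hn.2.2]
    rw [← S.energy_apply]
    change _ + e (v m - v n) < ε
    linarith
  have hnn : ∀ n, 0 ≤ S.energy (v n - u) (v n - u) := fun n => S.energy_self_nonneg _
  simp only [← S.energy_apply] at hu
  have hu1 : Tendsto (fun n => ‖v n - u‖) atTop (𝓝 0) :=
    squeeze_zero (fun _ => norm_nonneg _) (fun n => by linarith [hnn n]) hu
  have hu2 : Tendsto (fun n => S.energy (v n - u) (v n - u)) atTop (𝓝 0) :=
    squeeze_zero hnn (fun n => by linarith [norm_nonneg (v n - u)]) hu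
  have huW : (u : Lp ℝ 2 P) = W := by
    refine tendsto_nhds_unique ?_ hvW
    exact (continuous_subtype_val.tendsto u).comp (tendsto_iff_norm_sub_tendsto_zero.2 hu1)
  subst huW
  refine ⟨u.2, ?_⟩
  have hlim : Tendsto (fun n : ℕ => C + 1 / ((n : ℝ) + 1)) atTop (𝓝 C) := by
    simpa using tendsto_const_nhds.add (tendsto_one_div_add_atTop_nhds_zero_nat (𝕜 := ℝ))
  exact le_of_tendsto_of_tendsto' (S.tendsto_energy hu2 hu2) hlim fun n =>
    (hve n).le.trans (by linarith [hdC n])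

end ErrorStructure

/-! ### Smooth truncation and almost sure limits -/

theorem hasDerivAt_mul_sin_div {M : ℝ} (hM : 0 < M) (x : ℝ) :
    HasDerivAt (fun x => M * Real.sin (x / M)) (Real.cos (x / M)) x := by
  have h : HasDerivAt (fun x => M * Real.sin (x / M)) (M * (Real.cos (x / M) * (1 / M))) x :=
    (((hasDerivAt_id x).div_const M).sin).const_mul M
  rwa [mul_left_comm, mul_one_div_cancel hM.ne', mul_one] at h

theorem abs_mul_sin_div_le {M : ℝ} (hM : 0 < M) (x : ℝ) : |M * Real.sin (x / M)| ≤ |x| := by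
  have h := Real.abs_sin_le_abs (x := x / M)
  rw [abs_mul, abs_of_pos hM]
  rw [abs_div, abs_of_pos hM, le_div_iff₀ hM] at h
  linarith

theorem tendsto_mul_sin_div (x : ℝ) :
    Tendsto (fun n : ℕ => ((n : ℝ) + 1) * Real.sin (x / ((n : ℝ) + 1))) atTop (𝓝 x) := by
  rcases eq_or_ne x 0 with rfl | hx
  · simp
  have hs : Tendsto (fun y : ℝ => Real.sin y / y) (𝓝[≠] 0) (𝓝 1) := by
    have h := (Real.hasDerivAt_sin 0).tendsto_slope_zero
    simpa [div_eq_inv_mul] using h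
  have hn : Tendsto (fun n : ℕ => x / ((n : ℝ) + 1)) atTop (𝓝[≠] 0) := by
    refine tendsto_nhdsWithin_iff.2 ⟨?_, Eventually.of_forall fun n =>
      div_ne_zero hx (by positivity)⟩
    simpa [div_eq_mul_inv] using
      (tendsto_one_div_add_atTop_nhds_zero_nat (𝕜 := ℝ)).const_mul x
  have h := (hs.comp hn).const_mul x
  rw [mul_one] at h
  refine h.congr fun n => ?_
  have : (n : ℝ) + 1 ≠ 0 := by positivity
  simp only [Function.comp_apply]
  field_simp

namespace ErrorStructure

variable {Ω : Type*} [MeasurableSpace Ω] {P : Measure Ω} [IsProbabilityMeasure P]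
  (S : ErrorStructure P)

/-- M sin(x/M) is a bounded truncation of class C¹ with derivative cos(x/M); the chain rule
multiplies Γ by cos² ≤ 1. -/
theorem exists_truncation (u : S.dom) {M : ℝ} (hM : 0 < M) :
    ∃ v : S.dom, (∀ᵐ ω ∂P, (v : Lp ℝ 2 P) ω = M * Real.sin ((u : Lp ℝ 2 P) ω / M)) ∧
      S.energy v v ≤ S.energy u u := by
  have hderiv := fun x => (hasDerivAt_mul_sin_div hM x).deriv
  have hcd : ContDiff ℝ 1 fun x => M * Real.sin (x / M) :=
    contDiff_const.mul (Real.contDiff_sin.comp (contDiff_id.div_const M))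
  have hlip : LipschitzWith 1 fun x => M * Real.sin (x / M) := by
    refine lipschitzWith_of_nnnorm_deriv_le (fun x =>
      (hasDerivAt_mul_sin_div hM x).differentiableAt) fun x => ?_
    rw [hderiv, ← NNReal.coe_le_coe, coe_nnnorm, Real.norm_eq_abs]
    exact Real.abs_cos_le_one _
  obtain ⟨v, v', hv, hv', hΓ⟩ := S.chain _ _ hcd ⟨1, hlip⟩ hcd ⟨1, hlip⟩ u u
  obtain rfl : v = v' := Subtype.ext (Lp.ext (hv.trans hv'.symm))
  refine ⟨v, hv, ?_⟩
  rw [energy_apply, energy_apply]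
  refine integral_mono_ae (memLp_one_iff_integrable.1 (Lp.memLp _))
    (memLp_one_iff_integrable.1 (Lp.memLp _)) ?_
  filter_upwards [hΓ, S.nonneg u] with ω h1 h2
  rw [h1, hderiv, ← sq]
  exact mul_le_of_le_one_left h2 (Real.cos_sq_le_one _)

/-- The energy is lower semicontinuous for almost sure convergence to an element of `L²`. -/
theorem exists_mem_dom_of_ae_tendsto {w : ℕ → S.dom} {W : Lp ℝ 2 P}
    (hw : ∀ᵐ ω ∂P, Tendsto (fun n => (w n : Lp ℝ 2 P) ω) atTop (𝓝 (W ω))) {C : ℝ}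
    (hC : ∀ n, S.energy (w n) (w n) ≤ C) :
    ∃ h : W ∈ S.dom, S.energy ⟨W, h⟩ ⟨W, h⟩ ≤ C := by
  have hWs : AEStronglyMeasurable W P := Lp.aestronglyMeasurable W
  -- Two limits: at a fixed truncation level, boundedness turns almost sure convergence into L²
  -- convergence; then the level goes to infinity, dominated by |W|.
  have htrunc : ∀ m : ℕ, ∃ z : S.dom,
      (∀ᵐ ω ∂P, (z : Lp ℝ 2 P) ω = ((m : ℝ) + 1) * Real.sin (W ω / ((m : ℝ) + 1))) ∧
      S.energy z z ≤ C := by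
    intro m
    have hM : (0 : ℝ) < (m : ℝ) + 1 := by positivity
    choose z hz hze using fun n => S.exists_truncation (w n) hM
    have hcont : Continuous fun x : ℝ => ((m : ℝ) + 1) * Real.sin (x / ((m : ℝ) + 1)) := by
      fun_prop
    have hmem : MemLp (fun ω => ((m : ℝ) + 1) * Real.sin (W ω / ((m : ℝ) + 1))) 2 P :=
      (Lp.memLp W).mono (hcont.comp_aestronglyMeasurable hWs)
        (Eventually.of_forall fun ω => abs_mul_sin_div_le hM (W ω))
    have hlim : Tendsto (fun n => (z n : Lp ℝ 2 P)) atTop (𝓝 (hmem.toLp _)) := by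
      refine Lp.tendsto_two_of_dominated (b := fun _ => (m : ℝ) + 1) (memLp_const _) (fun n => ?_) ?_
      · filter_upwards [hz n] with ω h
        rw [h, abs_mul, abs_of_pos hM]
        exact mul_le_of_le_one_right hM.le (Real.abs_sin_le_one _)
      · filter_upwards [ae_all_iff.2 hz, hw, hmem.coeFn_toLp] with ω h1 h2 h3
        rw [h3]
        simp only [h1]
        exact (hcont.tendsto _).comp h2
    obtain ⟨h, hle⟩ := S.exists_mem_dom_of_tendsto hlim fun n => (hze n).trans (hC n)
    exact ⟨⟨_, h⟩, hmem.coeFn_toLp, hle⟩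
  choose z hz hze using htrunc
  refine S.exists_mem_dom_of_tendsto (w := z) ?_ hze
  refine Lp.tendsto_two_of_dominated (b := fun ω => |W ω|) (Lp.memLp W).abs (fun m => ?_) ?_
  · filter_upwards [hz m] with ω h
    rw [h]
    exact abs_mul_sin_div_le (by positivity) _
  · filter_upwards [ae_all_iff.2 hz] with ω h
    simp only [h]
    exact tendsto_mul_sin_div _

/-! ### Series with uncorrelated errors -/

section Series

variable {I : Type*} {a : I → S.dom}

theorem Γ_sum_sum (horth : ∀ i j, i ≠ j → S.Γ (a i) (a j) = 0) (c c' : I → ℝ) (J : Finset I) :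
    S.Γ (∑ i ∈ J, c i • a i) (∑ i ∈ J, c' i • a i) = ∑ i ∈ J, (c i * c' i) • S.Γ (a i) (a i) := by
  simp only [map_sum, LinearMap.sum_apply, map_smul, LinearMap.smul_apply]
  refine Finset.sum_congr rfl fun i hi => ?_
  rw [Finset.sum_eq_single i (fun j _ hj => by rw [horth j i hj]; simp) (fun h => absurd hi h),
    smul_smul, mul_comm]

theorem energy_sum (horth : ∀ i j, i ≠ j → S.Γ (a i) (a j) = 0) (c : I → ℝ) (J : Finset I) :
    S.energy (∑ i ∈ J, c i • a i) (∑ i ∈ J, c i • a i) =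
      ∑ i ∈ J, c i ^ 2 * S.energy (a i) (a i) := by
  change L1.integralCLM (S.Γ _ _) = _
  rw [S.Γ_sum_sum horth, map_sum]
  refine Finset.sum_congr rfl fun i _ => ?_
  rw [map_smul, smul_eq_mul, sq]
  rfl

theorem coeFn_sum_smul (c : I → ℝ) (J : Finset I) :
    ((∑ i ∈ J, c i • a i : S.dom) : Lp ℝ 2 P) =ᵐ[P]
      fun ω => ∑ i ∈ J, (a i : Lp ℝ 2 P) ω * c i := by
  rw [Submodule.coe_sum]
  refine (Lp.coeFn_fun_finsetSum J _).trans ?_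
  have h : ∀ᵐ ω ∂P, ∀ i ∈ J, (c i • (a i : Lp ℝ 2 P) : Lp ℝ 2 P) ω = (a i : Lp ℝ 2 P) ω * c i := by
    rw [Finset.eventually_all J]
    intro i _
    filter_upwards [Lp.coeFn_smul (c i) (a i : Lp ℝ 2 P)] with ω h
    rw [h, Pi.smul_apply, smul_eq_mul, mul_comm]
  filter_upwards [h] with ω h
  exact Finset.sum_congr rfl h

theorem exists_mem_dom_of_hasSum (horth : ∀ i j, i ≠ j → S.Γ (a i) (a j) = 0) {c : I → ℝ}
    {X : Lp ℝ 2 P} (hX : ∀ᵐ ω ∂P, HasSum (fun i => (a i : Lp ℝ 2 P) ω * c i) (X ω))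
    (hs : Summable fun i => c i ^ 2 * S.energy (a i) (a i)) {J : ℕ → Finset I} (hJ : Monotone J)
    (hJt : Tendsto J atTop atTop) :
    ∃ h : X ∈ S.dom, Tendsto (fun n => S.energy (∑ i ∈ J n, c i • a i - ⟨X, h⟩)
      (∑ i ∈ J n, c i • a i - ⟨X, h⟩)) atTop (𝓝 0) := by
  classical
  set s : ℕ → S.dom := fun n => ∑ i ∈ J n, c i • a i with hsdef
  have hnn : ∀ i, 0 ≤ c i ^ 2 * S.energy (a i) (a i) := fun i =>
    mul_nonneg (sq_nonneg _) (S.energy_self_nonneg _)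
  -- Lower semicontinuity is applied to the tails: X - s n is the almost sure limit of s (m + n) - s
  -- n, whose energy is at most the remainder of the energy series.
  have hstep : ∀ n, ∃ h : X - s n ∈ S.dom, S.energy ⟨X - s n, h⟩ ⟨X - s n, h⟩ ≤
      ∑' i, c i ^ 2 * S.energy (a i) (a i) - ∑ i ∈ J n, c i ^ 2 * S.energy (a i) (a i) := by
    intro n
    refine S.exists_mem_dom_of_ae_tendsto (w := fun m => s (m + n) - s n) ?_ fun m => ?_
    · filter_upwards [hX, ae_all_iff.2 fun m => S.coeFn_sum_smul (a := a) c (J m),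
        ae_all_iff.2 fun m => Lp.coeFn_sub (s (m + n) : Lp ℝ 2 P) (s n),
        Lp.coeFn_sub X (s n : Lp ℝ 2 P)] with ω h1 h2 h3 h4
      rw [h4]
      simp only [Submodule.coe_sub, h3, Pi.sub_apply]
      refine Tendsto.sub_const ?_ _
      have h5 : Tendsto (fun m => (s m : Lp ℝ 2 P) ω) atTop (𝓝 (X ω)) := by
        simp only [hsdef, h2]
        exact h1.comp hJt
      exact h5.comp (tendsto_add_atTop_nat n)
    · have hsub : J n ⊆ J (m + n) := hJ (Nat.le_add_left n m)
      have h1 : s (m + n) - s n = ∑ i ∈ J (m + n) \ J n, c i • a i := by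
        rw [sub_eq_iff_eq_add, hsdef, Finset.sum_sdiff hsub]
      rw [h1, S.energy_sum horth, le_sub_iff_add_le, Finset.sum_sdiff hsub]
      exact hs.sum_le_tsum _ fun i _ => hnn i
  have hXmem : X ∈ S.dom := by
    have := S.dom.add_mem (hstep 0).choose (s 0).2
    rwa [sub_add_cancel] at this
  refine ⟨hXmem, ?_⟩
  have hlim : Tendsto (fun n => ∑' i, c i ^ 2 * S.energy (a i) (a i) -
      ∑ i ∈ J n, c i ^ 2 * S.energy (a i) (a i)) atTop (𝓝 0) := by
    have h := hs.hasSum.comp hJt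
    rw [← sub_self (∑' i, c i ^ 2 * S.energy (a i) (a i))]
    exact tendsto_const_nhds.sub h
  refine squeeze_zero (fun n => S.energy_self_nonneg _) (fun n => ?_) hlim
  rw [← S.energy_neg_self, neg_sub]
  exact (hstep n).choose_spec

/-- L¹ convergence gives almost sure convergence only along a subsequence of partial sums. For c =
c' the terms are nonnegative, so this already forces summability; |c c'| ≤ c² + c'² then gives
absolute summability of the mixed series, whose sum the subsequence identifies. -/
theorem exists_mem_dom_hasSum_Γ [Countable I] (horth : ∀ i j, i ≠ j → S.Γ (a i) (a j) = 0)
    {c c' : I → ℝ} {X X' : Lp ℝ 2 P}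
    (hX : ∀ᵐ ω ∂P, HasSum (fun i => (a i : Lp ℝ 2 P) ω * c i) (X ω))
    (hX' : ∀ᵐ ω ∂P, HasSum (fun i => (a i : Lp ℝ 2 P) ω * c' i) (X' ω))
    (hs : Summable fun i => c i ^ 2 * S.energy (a i) (a i))
    (hs' : Summable fun i => c' i ^ 2 * S.energy (a i) (a i)) :
    ∃ (h : X ∈ S.dom) (h' : X' ∈ S.dom), ∀ᵐ ω ∂P,
      HasSum (fun i => c i * c' i * S.Γ (a i) (a i) ω) (S.Γ ⟨X, h⟩ ⟨X', h'⟩ ω) := by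
  obtain ⟨J, hJ, hJt⟩ := exists_seq_monotone_tendsto_atTop_atTop (Finset I)
  obtain ⟨h, hlim⟩ := S.exists_mem_dom_of_hasSum horth hX hs hJ hJt
  obtain ⟨h', hlim'⟩ := S.exists_mem_dom_of_hasSum horth hX' hs' hJ hJt
  refine ⟨h, h', ?_⟩
  have hsub : ∀ (d d' : I → ℝ) (Y Y' : S.dom),
      Tendsto (fun n => S.energy (∑ i ∈ J n, d i • a i - Y) (∑ i ∈ J n, d i • a i - Y))
        atTop (𝓝 0) →
      Tendsto (fun n => S.energy (∑ i ∈ J n, d' i • a i - Y') (∑ i ∈ J n, d' i • a i - Y'))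
        atTop (𝓝 0) →
      ∃ ns : ℕ → ℕ, StrictMono ns ∧ ∀ᵐ ω ∂P, Tendsto
        (fun k => ∑ i ∈ J (ns k), d i * d' i * S.Γ (a i) (a i) ω) atTop (𝓝 (S.Γ Y Y' ω)) := by
    intro d d' Y Y' hd hd'
    obtain ⟨ns, hns, hae⟩ :=
      (tendstoInMeasure_of_tendsto_Lp (S.tendsto_Γ hd hd')).exists_seq_tendsto_ae
    refine ⟨ns, hns, ?_⟩
    have h1 : ∀ n, ∀ᵐ ω ∂P, S.Γ (∑ i ∈ J n, d i • a i) (∑ i ∈ J n, d' i • a i) ω =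
        ∑ i ∈ J n, d i * d' i * S.Γ (a i) (a i) ω := fun n => by
      rw [S.Γ_sum_sum horth]
      filter_upwards [Lp.coeFn_fun_finsetSum (J n) fun i => (d i * d' i) • S.Γ (a i) (a i),
        ae_all_iff.2 fun i => Lp.coeFn_smul (d i * d' i) (S.Γ (a i) (a i))] with ω h2 h3
      rw [h2]
      exact Finset.sum_congr rfl fun i _ => by rw [h3, Pi.smul_apply, smul_eq_mul]
    filter_upwards [hae, ae_all_iff.2 h1] with ω h2 h3
    exact h2.congr fun k => h3 (ns k)
  have hsummable : ∀ (d : I → ℝ) (Y : S.dom),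
      Tendsto (fun n => S.energy (∑ i ∈ J n, d i • a i - Y) (∑ i ∈ J n, d i • a i - Y))
        atTop (𝓝 0) → ∀ᵐ ω ∂P, Summable fun i => d i * d i * S.Γ (a i) (a i) ω := by
    intro d Y hd
    obtain ⟨ns, hns, hae⟩ := hsub d d Y Y hd hd
    filter_upwards [hae, ae_all_iff.2 fun i => S.nonneg (a i)] with ω h1 h2
    have hnn : ∀ i, 0 ≤ d i * d i * S.Γ (a i) (a i) ω := fun i =>
      mul_nonneg (mul_self_nonneg _) (h2 i)
    refine summable_of_sum_le hnn fun F => ge_of_tendsto h1 ?_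
    filter_upwards [(hJt.comp hns.tendsto_atTop).eventually_ge_atTop F] with k hk
    exact Finset.sum_le_sum_of_subset_of_nonneg hk fun i _ _ => hnn i
  obtain ⟨ns, hns, hae⟩ := hsub c c' ⟨X, h⟩ ⟨X', h'⟩ hlim hlim'
  filter_upwards [hae, hsummable c _ hlim, hsummable c' _ hlim',
    ae_all_iff.2 fun i => S.nonneg (a i)] with ω h1 h2 h3 h4
  have hsum : Summable fun i => c i * c' i * S.Γ (a i) (a i) ω := by
    refine Summable.of_norm_bounded (h2.add h3) fun i => ?_
    have h5 : 0 ≤ S.Γ (a i) (a i) ω := h4 i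
    rw [Real.norm_eq_abs, abs_mul, abs_of_nonneg h5, ← add_mul]
    refine mul_le_mul_of_nonneg_right ?_ h5
    rw [abs_le]
    constructor <;> nlinarith [sq_nonneg (c i + c' i), sq_nonneg (c i - c' i), sq_nonneg (c i),
      sq_nonneg (c' i)]
  have h6 := hsum.hasSum.comp (hJt.comp hns.tendsto_atTop)
  rw [tendsto_nhds_unique h1 h6]
  exact hsum.hasSum

end Series

end ErrorStructure

/-! ### Wavelet expansion and the covariance formula -/

theorem memLp_fatherWavelet {φ : ℝ → ℝ} (hφ : MemLp φ 2 volume) (k : ℤ) :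
    MemLp (fatherWavelet φ k) 2 volume :=
  hφ.comp_measurePreserving (measurePreserving_sub_right volume (k : ℝ))

theorem memLp_motherWavelet {ψ : ℝ → ℝ} (hψ : MemLp ψ 2 volume) (p : ℕ × ℤ) :
    MemLp (motherWavelet ψ p) 2 volume := by
  have hc : (2 : ℝ) ^ p.1 ≠ 0 := by positivity
  have h1 : MemLp (fun x => ψ (x - p.2)) 2 volume :=
    hψ.comp_measurePreserving (measurePreserving_sub_right volume (p.2 : ℝ))
  have hq : Measure.QuasiMeasurePreserving (fun x : ℝ => 2 ^ p.1 * x) volume volume := by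
    refine ⟨by fun_prop, ?_⟩
    rw [Real.map_volume_mul_left hc]
    exact Measure.smul_absolutelyContinuous
  have h2 : MemLp (fun x => ψ (2 ^ p.1 * x - p.2)) 2 volume :=
    (memLp_two_iff_integrable_sq (h1.1.comp_quasiMeasurePreserving hq)).2
      (h1.integrable_sq.comp_mul_left' hc)
  exact h2.const_mul _

/-- The values of a solution are the sums of the series of the values of the diffusionlets. -/
theorem LPDEUniquelySolvable.hasSum_of_hasWaveletExpansion {σ μ : ℝ → ℝ → ℝ} {O : Set ℝ}
    {𝒰 : Submodule ℝ (ℝ → ℝ → ℝ)} (H : LPDEUniquelySolvable σ μ O 𝒰) (hO : IsOpen O)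
    {φ ψ : ℝ → ℝ} (hφ : MemLp φ 2 volume) (hψ : MemLp ψ 2 volume)
    {Φ : ℤ → ℝ → ℝ → ℝ}
    (hΦ : ∀ k, Φ k ∈ 𝒰 ∧ IsLPDESolution σ μ O (fatherWavelet φ k) (Φ k))
    {Ψ : ℕ × ℤ → ℝ → ℝ → ℝ}
    (hΨ : ∀ p, Ψ p ∈ 𝒰 ∧ IsLPDESolution σ μ O (motherWavelet ψ p) (Ψ p))
    {t x : ℝ} (ht : t < 0) (hx : x ∈ O) {g : ℝ → ℝ} {a : ℤ → ℝ} {b : ℕ × ℤ → ℝ}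
    (hg : HasWaveletExpansion φ ψ g a b) {u : ℝ → ℝ → ℝ} (hu𝒰 : u ∈ 𝒰)
    (hu : IsLPDESolution σ μ O g u) :
    HasSum (fun i : ℤ ⊕ (ℕ × ℤ) =>
      Sum.elim a b i * Sum.elim (fun k => Φ k t x) (fun p => Ψ p t x) i) (u t x) := by
  obtain ⟨ℓ, hℓ⟩ := H.exists_continuousLinearMap_eval hO ht hx
  have hφk := memLp_fatherWavelet hφ
  have hψp := memLp_motherWavelet hψ
  let e : ℤ ⊕ (ℕ × ℤ) → Lp ℝ 2 (volume : Measure ℝ) :=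
    Sum.elim (fun k => a k • (hφk k).toLp _) (fun p => b p • (hψp p).toLp _)
  have he : HasSum e (hg.1.toLp g) := by
    rw [HasSum, tendsto_iff_edist_tendsto_0]
    -- Finite sets of the disjoint union correspond to pairs of finite sets, so the expansion is an
    -- unconditional sum over a single index.
    refine (hg.2.comp Finset.sumEquiv.tendsto_atTop).congr fun J => ?_
    rw [edist_comm, Lp.edist_def]
    refine eLpNorm_congr_ae ?_
    have hL : ∀ k, ∀ᵐ y : ℝ, e (Sum.inl k) y = a k * fatherWavelet φ k y := fun k => by
      filter_upwards [Lp.coeFn_smul (a k) ((hφk k).toLp _), (hφk k).coeFn_toLp] with y h1 h2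
      exact h1.trans (by rw [Pi.smul_apply, h2, smul_eq_mul])
    have hR : ∀ p, ∀ᵐ y : ℝ, e (Sum.inr p) y = b p * motherWavelet ψ p y := fun p => by
      filter_upwards [Lp.coeFn_smul (b p) ((hψp p).toLp _), (hψp p).coeFn_toLp] with y h1 h2
      exact h1.trans (by rw [Pi.smul_apply, h2, smul_eq_mul])
    filter_upwards [ae_all_iff.2 hL, ae_all_iff.2 hR, hg.1.coeFn_toLp,
      Lp.coeFn_fun_finsetSum J e] with y h1 h2 h3 h4
    rw [Pi.sub_apply, h3, h4]
    conv_rhs => rw [← Finset.toLeft_disjSum_toRight (u := J)]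
    rw [Finset.sum_disjSum]
    simp only [h1, h2]
    rfl
  have h := he.mapL ℓ
  rw [hℓ g hg.1 u hu𝒰 hu] at h
  convert h using 2 with i
  rcases i with k | p
  · simp only [e, Sum.elim_inl, map_smul, smul_eq_mul, hℓ _ (hφk k) _ (hΦ k).1 (hΦ k).2]
  · simp only [e, Sum.elim_inr, map_smul, smul_eq_mul, hℓ _ (hψp p) _ (hΨ p).1 (hΨ p).2]

theorem mainTheorem4 {Ω : Type*} [MeasurableSpace Ω] (P : Measure Ω) [IsProbabilityMeasure P]
    (S : ErrorStructure P)
    -- the wavelet basis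
    (φ ψ : ℝ → ℝ) (hφψ : IsWaveletBasis φ ψ)
    -- the random coefficients, with uncorrelated and proportional errors
    (α : ℤ → S.dom) (β : ℕ × ℤ → S.dom) (γ : ℤ → ℝ) (γ' : ℕ × ℤ → ℝ)
    (huncorr : S.Uncorrelated α β) (hprop : S.Proportional α β γ γ')
    -- the random terminal condition with these coefficients
    (f : Ω → ℝ → ℝ)
    (hf : ∀ᵐ ω ∂P, HasWaveletExpansion φ ψ (f ω)
      (fun k => (α k : Lp ℝ 2 P) ω) (fun p => (β p : Lp ℝ 2 P) ω))
    -- the equation, its solution `Q` and its diffusionlets `Φ`, `Ψ`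
    (σ μ : ℝ → ℝ → ℝ) (O : Set ℝ) (hO : IsOpen O) (𝒰 : Submodule ℝ (ℝ → ℝ → ℝ))
    (hLPDE : LPDEUniquelySolvable σ μ O 𝒰)
    (Q : Ω → ℝ → ℝ → ℝ) (hQ : ∀ᵐ ω ∂P, Q ω ∈ 𝒰 ∧ IsLPDESolution σ μ O (f ω) (Q ω))
    (Φ : ℤ → ℝ → ℝ → ℝ)
    (hΦ : ∀ k, Φ k ∈ 𝒰 ∧ IsLPDESolution σ μ O (fatherWavelet φ k) (Φ k))
    (Ψ : ℕ × ℤ → ℝ → ℝ → ℝ)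
    (hΨ : ∀ p, Ψ p ∈ 𝒰 ∧ IsLPDESolution σ μ O (motherWavelet ψ p) (Ψ p))
    -- two space-time points at which the solution and its error have a finite second moment
    (t x s y : ℝ) (ht : t < 0) (hx : x ∈ O) (hs : s < 0) (hy : y ∈ O)
    (hQtx : MemLp (fun ω => Q ω t x) 2 P) (hQsy : MemLp (fun ω => Q ω s y) 2 P)
    (hΦtx : Summable fun k => γ k * (∫ ω, (α k : Lp ℝ 2 P) ω ^ 2 ∂P) * Φ k t x ^ 2)
    (hΨtx : Summable fun p => γ' p * (∫ ω, (β p : Lp ℝ 2 P) ω ^ 2 ∂P) * Ψ p t x ^ 2)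
    (hΦsy : Summable fun k => γ k * (∫ ω, (α k : Lp ℝ 2 P) ω ^ 2 ∂P) * Φ k s y ^ 2)
    (hΨsy : Summable fun p => γ' p * (∫ ω, (β p : Lp ℝ 2 P) ω ^ 2 ∂P) * Ψ p s y ^ 2) :
    ∃ (htx : hQtx.toLp (fun ω => Q ω t x) ∈ S.dom) (hsy : hQsy.toLp (fun ω => Q ω s y) ∈ S.dom),
      ∀ᵐ ω ∂P,
        (Summable fun k => γ k * (α k : Lp ℝ 2 P) ω ^ 2 * Φ k t x * Φ k s y) ∧
        (Summable fun p => γ' p * (β p : Lp ℝ 2 P) ω ^ 2 * Ψ p t x * Ψ p s y) ∧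
        S.Γ ⟨_, htx⟩ ⟨_, hsy⟩ ω =
          ∑' k : ℤ, γ k * (α k : Lp ℝ 2 P) ω ^ 2 * Φ k t x * Φ k s y
          + ∑' (i : ℕ) (k : ℤ),
              γ' (i, k) * (β (i, k) : Lp ℝ 2 P) ω ^ 2 * Ψ (i, k) t x * Ψ (i, k) s y := by
  have hOrth : ∀ i j, i ≠ j →
      S.Γ ((Sum.elim α β : ℤ ⊕ (ℕ × ℤ) → S.dom) i) ((Sum.elim α β : ℤ ⊕ (ℕ × ℤ) → S.dom) j) = 0 := by
    rintro (k | p) (l | q) hij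
    · exact huncorr.father k l fun h => hij (h ▸ rfl)
    · exact huncorr.father_mother k q
    · exact (S.symm _ _).trans (huncorr.father_mother l p)
    · exact huncorr.mother p q fun h => hij (h ▸ rfl)
  have hseries : ∀ r z, r < 0 → z ∈ O → ∀ hQrz : MemLp (fun ω => Q ω r z) 2 P,
      ∀ᵐ ω ∂P, HasSum (fun i : ℤ ⊕ (ℕ × ℤ) =>
        ((Sum.elim α β i : S.dom) : Lp ℝ 2 P) ω * Sum.elim (fun k => Φ k r z) (fun p => Ψ p r z) i)
        (hQrz.toLp (fun ω => Q ω r z) ω) := by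
    intro r z hr hz hQrz
    filter_upwards [hf, hQ, hQrz.coeFn_toLp] with ω h1 h2 h3
    rw [h3]
    convert hLPDE.hasSum_of_hasWaveletExpansion hO hφψ.memLp_father hφψ.memLp_mother hΦ hΨ hr hz h1
      h2.1 h2.2 using 2 with i
    rcases i with k | p <;> rfl
  -- Proportional errors turn the assumed second-moment series into the energy series of the
  -- expansion.
  have henergyα : ∀ k, S.energy (α k) (α k) = γ k * ∫ ω, (α k : Lp ℝ 2 P) ω ^ 2 ∂P := fun k => by
    rw [S.energy_apply, integral_congr_ae (hprop.father k), integral_const_mul]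
  have henergyβ : ∀ p, S.energy (β p) (β p) = γ' p * ∫ ω, (β p : Lp ℝ 2 P) ω ^ 2 ∂P := fun p => by
    rw [S.energy_apply, integral_congr_ae (hprop.mother p), integral_const_mul]
  have hsummable : ∀ r z,
      (Summable fun k => γ k * (∫ ω, (α k : Lp ℝ 2 P) ω ^ 2 ∂P) * Φ k r z ^ 2) →
      (Summable fun p => γ' p * (∫ ω, (β p : Lp ℝ 2 P) ω ^ 2 ∂P) * Ψ p r z ^ 2) →
      Summable fun i : ℤ ⊕ (ℕ × ℤ) =>
        (Sum.elim (fun k => Φ k r z) (fun p => Ψ p r z) i : ℝ) ^ 2 *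
          S.energy (Sum.elim α β i) (Sum.elim α β i) := by
    intro r z h1 h2
    refine Summable.sum _ (h1.congr fun k => ?_) (h2.congr fun p => ?_)
    · rw [← henergyα, mul_comm]; rfl
    · rw [← henergyβ, mul_comm]; rfl
  obtain ⟨htx, hsy, hΓ⟩ := S.exists_mem_dom_hasSum_Γ hOrth (hseries t x ht hx hQtx)
    (hseries s y hs hy hQsy) (hsummable t x hΦtx hΨtx) (hsummable s y hΦsy hΨsy)
  refine ⟨htx, hsy, ?_⟩
  filter_upwards [hΓ, ae_all_iff.2 hprop.father, ae_all_iff.2 hprop.mother] with ω h h1 h2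
  have e1 : ∀ k, Φ k t x * Φ k s y * S.Γ (α k) (α k) ω =
      γ k * (α k : Lp ℝ 2 P) ω ^ 2 * Φ k t x * Φ k s y := fun k => by rw [h1]; ring
  have e2 : ∀ p, Ψ p t x * Ψ p s y * S.Γ (β p) (β p) ω =
      γ' p * (β p : Lp ℝ 2 P) ω ^ 2 * Ψ p t x * Ψ p s y := fun p => by rw [h2]; ring
  have s1 : Summable fun k => γ k * (α k : Lp ℝ 2 P) ω ^ 2 * Φ k t x * Φ k s y :=
    (h.summable.comp_injective Sum.inl_injective).congr e1
  have s2 : Summable fun p => γ' p * (β p : Lp ℝ 2 P) ω ^ 2 * Ψ p t x * Ψ p s y :=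
    (h.summable.comp_injective Sum.inr_injective).congr e2
  refine ⟨s1, s2, ?_⟩
  -- Absolute convergence allows the iterated sum over i and k to be taken as one sum over pairs.
  rw [← s2.tsum_prod]
  refine h.unique (HasSum.sum ?_ ?_)
  · exact s1.hasSum.congr_fun fun k => e1 k
  · exact s2.hasSum.congr_fun fun p => e2 p
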